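/- Let $F$ be a local field of characteristic zero, let $M$ be an affine algebraic group over $F$ (an affine group scheme of finite type), and give $M(F)$ the topology induced by that of $F$. Let $m$ be a nonzero integer, $\mu_m=\{\varepsilon\in\mathbb{C}^\times:\varepsilon^m=1\}$, and let $$1\to\mu_m\to\tilde M\xrightarrow{\ \mathbf{p}\ }M(F)\to1$$ be a central extension of topological groups. Write $M_{\mathrm{unip}}(F)$ for the set of unipotent elements of $M(F)$, with the subspace topology. (1) There is exactly one continuous section $s:M_{\mathrm{unip}}(F)\to\tilde M$ of $\mathbf{p}$ (that is, $\mathbf{p}(s(u))=u$ for all $u$) such that - for every unipotent algebraic subgroup $U$ of $M$ defined over $F$, the restriction $s|_{U(F)}$ is a group homomorphism; - $s$ is invariant under conjugation: $s(yuy^{-1})=\tilde y\,s(u)\,\tilde y^{-1}$ for all $u\in M_{\mathrm{unip}}(F)$ and $\tilde y\in\tilde M$, where $y=\mathbf{p}(\tilde y)$. Let $s$ be this section. (2) For every $\tilde x\in\tilde M$ there is exactly one pair $(\tilde\sigma,u)\in\tilde M\times M_{\mathrm{unip}}(F)$ such that $\mathbf{p}(\tilde\sigma)$ is semisimple in $M(F)$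 and $\tilde x=\tilde\sigma\,s(u)=s(u)\,\tilde\sigma$ (the Jordan decomposition of $\tilde x$). (3) If $(\tilde\sigma,u)$ is the Jordan decomposition of $\tilde x$ and $\tilde y\in\tilde M$, then $\tilde y$ commutes with $\tilde x$ if and only if $\tilde y$ commutes with $\tilde\sigma$ in $\tilde M$ and $\mathbf{p}(\tilde y)$ commutes with $u$ in $M(F)$. -/

import Mathlib

open scoped TensorProduct Topology

noncomputable section

/-- A local field: a non-discrete locally compact Hausdorff topological field. -/
class IsLocalField (F : Type*) [Field F] [TopologicalSpace F] : Prop extends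
    IsTopologicalDivisionRing F, T2Space F, LocallyCompactSpace F where
  nondiscrete : (𝓝[≠] (0 : F)).NeBot

namespace AffineGroup

/-- The group `M(F)` of `F`-points of the affine group scheme `M = Spec A`, where `A` is a
commutative Hopf algebra over `F`: the algebra homomorphisms `A → F`, with the group law
`(x * y) a = ∑ x a₍₁₎ * y a₍₂₎` (this is Mathlib's convolution group). -/
abbrev Points (F A : Type*) [Field F] [CommRing A] [HopfAlgebra F A] : Type _ :=
  WithConv (A →ₐ[F] F)

variable {F A : Type*} [Field F] [CommRing A] [HopfAlgebra F A]

/-- The topology on `M(F)` induced by that of `F`: the coarsest one for which every regular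
function `a ∈ A` is continuous on `M(F)`. -/
instance [TopologicalSpace F] : TopologicalSpace (Points F A) :=
  TopologicalSpace.induced (fun (x : Points F A) (a : A) => x.ofConv a) inferInstance

/-- Right translation of regular functions by a point `x ∈ M(F)`: `a ↦ ∑ x a₍₂₎ • a₍₁₎`, that is,
`(translation x a) y = a (y * x)`. -/
def translation (x : Points F A) : Module.End F A :=
  (TensorProduct.rid F A).toLinearMap ∘ₗ x.ofConv.toLinearMap.lTensor A ∘ₗ Coalgebra.comul

/-- `x ∈ M(F)` is unipotent: right translation by `x` is a (locally) unipotent operator on the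
regular functions. -/
def IsUnipotent (x : Points F A) : Prop :=
  ∀ a : A, ∃ n : ℕ, ((translation x - 1) ^ n) a = 0

/-- `x ∈ M(F)` is semisimple: right translation by `x`, which is a locally finite operator on the
regular functions, is semisimple (used over a perfect field only). -/
def IsSemisimple (x : Points F A) : Prop :=
  (translation x).IsSemisimple

/-- The set `M_unip(F)` of unipotent elements of `M(F)`. -/
def unip (F A : Type*) [Field F] [CommRing A] [HopfAlgebra F A] : Set (Points F A) :=
  {x | IsUnipotent x}

/-- `c` is the matrix of an `n`-dimensional linear representation of the affine group scheme
`Spec B`: comultiplicative, with value the identity matrix at the neutral element. -/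
structure IsMatrixRep {B : Type*} [CommRing B] [HopfAlgebra F B] {n : ℕ}
    (c : Matrix (Fin n) (Fin n) B) : Prop where
  comul_apply : ∀ i j, Coalgebra.comul (R := F) (c i j) = ∑ k, c i k ⊗ₜ[F] c k j
  counit_apply : ∀ i j, Coalgebra.counit (R := F) (c i j) = if i = j then 1 else 0

/-- The affine group scheme `Spec B` over `F` is unipotent: every nonzero finite-dimensional linear
representation has a nonzero fixed vector. -/
def IsUnipotentGroup (F B : Type*) [Field F] [CommRing B] [HopfAlgebra F B] : Prop :=
  ∀ (n : ℕ) (c : Matrix (Fin n) (Fin n) B), 0 < n → IsMatrixRep (F := F) c →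
    ∃ v : Fin n → F, v ≠ 0 ∧ ∀ i, ∑ j, v j • c i j = algebraMap F B (v i)

/-- The subgroup `U(F) ⊆ M(F)` of `F`-points of the closed subgroup scheme `U = Spec (A ⧸ I)` of
`M = Spec A` defined by the Hopf ideal `I`. -/
def subgroupPoints (I : Ideal A) [I.IsHopfIdeal F] : Subgroup (Points F A) where
  carrier := {x | ∀ a ∈ I, x.ofConv a = 0}
  one_mem' := fun a ha => by
    have h : Coalgebra.counit (R := F) a = 0 :=
      Submodule.IsCoideal.counit_eq_zero (I := I.restrictScalars F) ha
    change algebraMap F F (Coalgebra.counit a) = 0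
    simp [h]
  mul_mem' := fun {x y} hx hy a ha => by
    have h := Submodule.IsCoideal.map_mkQ_comul_eq_zero (I := I.restrictScalars F) ha
    let x' := (I.restrictScalars F).liftQ x.ofConv.toLinearMap hx
    let y' := (I.restrictScalars F).liftQ y.ofConv.toLinearMap hy
    have hx' : x.ofConv.toLinearMap = x' ∘ₗ (I.restrictScalars F).mkQ := by ext; rfl
    have hy' : y.ofConv.toLinearMap = y' ∘ₗ (I.restrictScalars F).mkQ := by ext; rfl
    change LinearMap.mul' F F (TensorProduct.map x.ofConv.toLinearMap y.ofConv.toLinearMap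
      (Coalgebra.comul a)) = 0
    rw [hx', hy', TensorProduct.map_comp, LinearMap.comp_apply, h, map_zero, map_zero]
  inv_mem' := fun {x} hx a ha => hx _ (Ideal.IsHopfIdeal.antipode_mem (R := F) ha)

/-- The group `μ_m` of complex numbers `ε` with `ε ^ m = 1`. -/
def mu (m : ℤ) : Subgroup ℂˣ :=
  (zpowGroupHom m : ℂˣ →* ℂˣ).ker

variable [TopologicalSpace F] {E : Type*} [Group E] [TopologicalSpace E]

/-- `1 → μ_m → E → M(F) → 1` is a covering of `M(F)` with `m` sheets: a central extension of
topological groups. -/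
structure IsCovering {m : ℤ} (inc : mu m →* E) (rev : E →* Points F A) : Prop where
  exact : TopologicalGroup.IsSES inc rev
  central : ∀ (ε : mu m) (y : E), inc ε * y = y * inc ε

/-- `s` is a unipotent splitting of `rev : E → M(F)`: a continuous section of `rev` over
`M_unip(F)`, whose restriction to `U(F) ⊆ M_unip(F)` is a homomorphism for every unipotent
algebraic subgroup `U` of `M` defined over `F`, and which is invariant under conjugation. -/
structure IsUnipotentSplitting (rev : E →* Points F A) (s : unip F A → E) : Prop where
  continuous : Continuous s
  section_apply : ∀ u : unip F A, rev (s u) = u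
  hom : ∀ (I : Ideal A) [I.IsHopfIdeal F], IsUnipotentGroup F (A ⧸ I) →
    ∃ f : subgroupPoints (F := F) I →* E,
      ∀ x : subgroupPoints (F := F) I, ∃ hx : (x : Points F A) ∈ unip F A, f x = s ⟨x, hx⟩
  conj : ∀ (y : E) (u : unip F A),
    ∃ h : rev y * u * (rev y)⁻¹ ∈ unip F A, s ⟨_, h⟩ = y * s u * y⁻¹

/-- `y = σ s(u) = s(u) σ` with `σ` of semisimple image and `u` unipotent: a Jordan decomposition
of `y ∈ E` relative to `s`. -/
structure IsJordanDecomposition (rev : E →* Points F A) (s : unip F A → E)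
    (y σ : E) (u : unip F A) : Prop where
  semisimple : IsSemisimple (rev σ)
  eq_mul : y = σ * s u
  comm : σ * s u = s u * σ

end AffineGroup

end

/-! `M(F)` acts faithfully and locally finitely on `A` by right translations, so questions about
points become linear algebra. If `u` is unipotent, then for each `a` the value of `a` at `u ^ n` is
a polynomial in `n`. In characteristic zero this extends `n ↦ u ^ n` to a one-parameter subgroup `t
↦ u ^ t` with `t ∈ F`, and `u` has exactly one unipotent `|m|`-th root (`unipRoot_pow`,
`IsUnipotent.eq_of_pow_eq`).

The kernel of `rev` is central and killed by `|m|`, so the `|m|`-th power of a lift depends only on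
the point lifted. The section sends `u` to the `|m|`-th power of any lift of its root. This choice
is forced: the Zariski closure of the powers of `u` is a unipotent subgroup containing `u` and its
root, and a splitting is a homomorphism there. Conjugation invariance can be read off the formula.
Continuity holds because the root is found by interpolating through finitely many powers of `u`,
their number depending only on `a` (`continuous_unipRoot`).

The main point is multiplicativity on `U(F)`. By the fixed vector property, `U(F)` acts by
unitriangular matrices in suitable bases, hence is nilpotent, and its `|m|`-th powers are bijective.
For such a group the section is a homomorphism, by induction through the quotient by the centre
(`section_mul_of_isNilpotent`).

For the Jordan decomposition, a locally finite operator over a perfect field has a semisimple part,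
which at each vector is a polynomial in the operator. For a translation this part is again an
algebra homomorphism commuting with left translations, hence a translation
(`exists_isSemisimplePart_translation`). The decomposition in `M(F)` then lifts: the semisimple
factor must be `x * (s u)⁻¹`, and conjugation invariance of `s` makes the factors commute. The
statement on centralizers follows from uniqueness, by conjugating a decomposition. -/

open scoped TensorProduct Topology

noncomputable section

namespace AffineGroup

/-! ### Right translations and operators commuting with left translations -/

section Translation

variable {F A : Type*} [Field F] [CommRing A] [HopfAlgebra F A]

@[ext]
lemma Points.ext {x y : Points F A} (h : ∀ a, x.ofConv a = y.ofConv a) : x = y :=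
  WithConv.ofConv_injective (AlgHom.ext h)

lemma translation_eq_sum {ι : Type*} (x : Points F A) {a : A} (r : Coalgebra.Repr F a ι) :
    translation x a = ∑ i ∈ r.index, x.ofConv (r.right i) • r.left i := by
  simp [translation, ← r.eq, map_sum]

lemma mul_apply_eq_sum {ι : Type*} (x y : Points F A) {a : A} (r : Coalgebra.Repr F a ι) :
    (x * y).ofConv a = ∑ i ∈ r.index, x.ofConv (r.left i) * y.ofConv (r.right i) := by
  have := AlgHom.convMul_apply x y a
  rw [← r.eq] at this
  simpa [map_sum] using this

lemma one_apply (a : A) : (1 : Points F A).ofConv a = Coalgebra.counit (R := F) a :=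
  AlgHom.convOne_apply a

lemma inv_apply (x : Points F A) (a : A) :
    x⁻¹.ofConv a = x.ofConv (HopfAlgebra.antipode F a) := rfl

lemma apply_translation (x y : Points F A) (a : A) :
    x.ofConv (translation y a) = (x * y).ofConv a := by
  have r := Coalgebra.Repr.arbitrary F a
  rw [translation_eq_sum y r, mul_apply_eq_sum x y r]
  simp [map_sum, mul_comm]

lemma counit_translation (y : Points F A) (a : A) :
    Coalgebra.counit (R := F) (translation y a) = y.ofConv a := by
  rw [← one_apply, apply_translation, one_mul]

lemma translation_injective : Function.Injective (translation (F := F) (A := A)) := by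
  intro x y h
  ext a
  rw [← counit_translation, h, counit_translation]

/-- Right translation by a point, as an algebra homomorphism. -/
def translationAlgHom (x : Points F A) : A →ₐ[F] A :=
  ((Algebra.TensorProduct.rid F F A).toAlgHom.comp
    (Algebra.TensorProduct.map (AlgHom.id F A) x.ofConv)).comp (Bialgebra.comulAlgHom F A)

lemma translationAlgHom_apply (x : Points F A) (a : A) :
    translationAlgHom x a = translation x a := by
  have r := Coalgebra.Repr.arbitrary F a
  rw [translation_eq_sum x r]
  simp [translationAlgHom, ← r.eq, map_sum]

lemma translation_apply_mul (x : Points F A) (a b : A) :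
    translation x (a * b) = translation x a * translation x b := by
  simp only [← translationAlgHom_apply, map_mul]

lemma translation_apply_one (x : Points F A) : translation x (1 : A) = 1 := by
  simp only [← translationAlgHom_apply, map_one]

/-- A linear endomorphism of `A` commuting with left translations. -/
def IsEquivariant (T : Module.End F A) : Prop :=
  Coalgebra.comul (R := F) ∘ₗ T = T.lTensor A ∘ₗ Coalgebra.comul (R := F) (A := A)

/-- This is coassociativity. It is needed for arbitrary functionals `φ`, not only for points, in the
construction of finite-dimensional subcomodules. -/
lemma isEquivariant_rid_lTensor (φ : A →ₗ[F] F) :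
    IsEquivariant ((TensorProduct.rid F A).toLinearMap ∘ₗ φ.lTensor A ∘ₗ Coalgebra.comul) := by
  have h1 : TensorProduct.assoc F A A F ∘ₗ
      ((Coalgebra.comul (R := F) (A := A)).rTensor F) ∘ₗ φ.lTensor A =
      (φ.lTensor A).lTensor A ∘ₗ TensorProduct.assoc F A A A ∘ₗ
        (Coalgebra.comul (R := F) (A := A)).rTensor A := by
    ext a b
    have r := Coalgebra.Repr.arbitrary F a
    simp [← r.eq, TensorProduct.sum_tmul, map_sum]
  have h2 : Coalgebra.comul (R := F) ∘ₗ (TensorProduct.rid F A).toLinearMap =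
      (TensorProduct.rid F A).toLinearMap.lTensor A ∘ₗ TensorProduct.assoc F A A F ∘ₗ
      ((Coalgebra.comul (R := F) (A := A)).rTensor F) := by
    ext a
    have r := Coalgebra.Repr.arbitrary F a
    simp [← r.eq, TensorProduct.sum_tmul, map_sum]
  rw [IsEquivariant, ← LinearMap.comp_assoc, h2, LinearMap.lTensor_comp, LinearMap.lTensor_comp,
    LinearMap.comp_assoc, LinearMap.comp_assoc, LinearMap.comp_assoc, LinearMap.comp_assoc,
    ← Coalgebra.coassoc (R := F) (A := A)]
  simp only [← LinearMap.comp_assoc]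
  congr 1
  simp only [LinearMap.comp_assoc]
  rw [h1]

lemma isEquivariant_translation (x : Points F A) : IsEquivariant (translation x) :=
  isEquivariant_rid_lTensor _

/-- Applying the counit to the second factor of the equivariance identity recovers `T`. So an
equivariant operator is determined by its composite with the counit, and is a translation once that
composite is a point. -/
lemma IsEquivariant.eq_rid_lTensor {T : Module.End F A} (hT : IsEquivariant T) :
    T = (TensorProduct.rid F A).toLinearMap ∘ₗ
      (Coalgebra.counit (R := F) ∘ₗ T).lTensor A ∘ₗ Coalgebra.comul := by
  rw [LinearMap.lTensor_comp, LinearMap.comp_assoc, ← hT, ← LinearMap.comp_assoc,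
    ← LinearMap.comp_assoc]
  ext a
  simp

lemma IsEquivariant.ext {S T : Module.End F A} (hS : IsEquivariant S) (hT : IsEquivariant T)
    (h : ∀ a, Coalgebra.counit (R := F) (S a) = Coalgebra.counit (R := F) (T a)) : S = T := by
  have : Coalgebra.counit (R := F) ∘ₗ S = Coalgebra.counit (R := F) ∘ₗ T := LinearMap.ext h
  rw [hS.eq_rid_lTensor, this, ← hT.eq_rid_lTensor]

lemma IsEquivariant.mul {S T : Module.End F A} (hS : IsEquivariant S) (hT : IsEquivariant T) :
    IsEquivariant (S * T) := by
  rw [IsEquivariant, Module.End.mul_eq_comp, LinearMap.lTensor_comp, ← LinearMap.comp_assoc, hS,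
    LinearMap.comp_assoc, hT, LinearMap.comp_assoc]

lemma isEquivariant_one : IsEquivariant (1 : Module.End F A) := by
  rw [IsEquivariant, Module.End.one_eq_id, LinearMap.lTensor_id]
  rfl

lemma translation_mul (x y : Points F A) :
    translation (x * y) = translation x * translation y := by
  refine (isEquivariant_translation _).ext
    ((isEquivariant_translation _).mul (isEquivariant_translation _)) fun a => ?_
  rw [Module.End.mul_apply, counit_translation, counit_translation, apply_translation]

lemma translation_one : translation (1 : Points F A) = 1 := by
  refine (isEquivariant_translation _).ext isEquivariant_one fun a => ?_
  rw [counit_translation, one_apply, Module.End.one_apply]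

/-- Right translation, as a homomorphism from `M(F)` to the endomorphisms of `A`. -/
def translationHom : Points F A →* Module.End F A where
  toFun := translation
  map_one' := translation_one
  map_mul' := translation_mul

lemma translation_pow (x : Points F A) (n : ℕ) : translation (x ^ n) = translation x ^ n :=
  map_pow translationHom x n

lemma translation_inv_mul (x : Points F A) : translation x⁻¹ * translation x = 1 := by
  rw [← translation_mul, inv_mul_cancel, translation_one]

lemma translation_mul_inv (x : Points F A) : translation x * translation x⁻¹ = 1 := by
  rw [← translation_mul, mul_inv_cancel, translation_one]

lemma commute_translation_iff {x y : Points F A} :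
    Commute (translation x) (translation y) ↔ Commute x y := by
  rw [commute_iff_eq, commute_iff_eq, ← translation_mul, ← translation_mul,
    translation_injective.eq_iff]

/-- A finite-dimensional space containing the orbit of the regular function `a`. -/
lemma exists_finite_translation_mem (a : A) : ∃ W : Submodule F A, Module.Finite F W ∧
    ∀ x : Points F A, translation x a ∈ W := by
  have r := Coalgebra.Repr.arbitrary F a
  refine ⟨Submodule.span F (r.left '' r.index),
    Module.Finite.span_of_finite F (r.index.finite_toSet.image _), fun x => ?_⟩
  rw [translation_eq_sum x r]
  exact Submodule.sum_mem _ fun i hi => Submodule.smul_mem _ _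
    (Submodule.subset_span (Set.mem_image_of_mem _ hi))

end Translation

end AffineGroup

/-! ### Polynomial orbits of unipotent operators -/

section PolynomialOrbit

open Polynomial

variable {F V : Type*} [Field F] [AddCommGroup V] [Module F V]

/-- If `(T - 1) ^ K` kills `v`, then `T ^ n v` depends polynomially on `n`. -/
lemma exists_polynomial_of_pow_sub_one_apply_eq_zero [CharZero F] (T : Module.End F V) (v : V)
    (K : ℕ) (h : ((T - 1) ^ K) v = 0) (φ : V →ₗ[F] F) :
    ∃ p : F[X], p.degree < K ∧ ∀ n : ℕ, φ ((T ^ n) v) = p.eval (n : F) := by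
  have hK : ∀ k, K ≤ k → ((T - 1) ^ k) v = 0 := fun k hk => by
    obtain ⟨j, rfl⟩ := Nat.exists_eq_add_of_le' hk
    rw [pow_add, Module.End.mul_apply, h, map_zero]
  have hT : ∀ n : ℕ, (T ^ n) v = ∑ k ∈ Finset.range K, (n.choose k : F) • ((T - 1) ^ k) v := by
    intro n
    have h1 : T ^ n = ∑ k ∈ Finset.range (n + 1), (T - 1) ^ k * (n.choose k : Module.End F V) := by
      have := (Commute.one_right (T - 1)).add_pow n
      simpa using this
    have h2 : (T ^ n) v = ∑ k ∈ Finset.range (n + 1), (n.choose k : F) • ((T - 1) ^ k) v := by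
      rw [h1, LinearMap.sum_apply]
      refine Finset.sum_congr rfl fun k _ => ?_
      rw [← Nat.cast_comm, Module.End.mul_apply, Module.End.natCast_apply, Nat.cast_smul_eq_nsmul]
    rw [h2]
    have h3 : Finset.range (n + 1) ⊆ Finset.range (max (n + 1) K) :=
      Finset.range_mono (le_max_left _ _)
    have h4 : Finset.range K ⊆ Finset.range (max (n + 1) K) :=
      Finset.range_mono (le_max_right _ _)
    rw [Finset.sum_subset h3, ← Finset.sum_subset h4]
    · intro k _ hk
      rw [hK k (by simpa using hk), smul_zero]
    · intro k _ hk
      rw [Nat.choose_eq_zero_of_lt (by simpa using hk), Nat.cast_zero, zero_smul]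
  -- Newton's form of the truncated binomial expansion: `n.choose k` is a falling factorial divided
  -- by `k!`, hence a polynomial of degree `k` in `n`.
  refine ⟨∑ k ∈ Finset.range K,
    C (φ (((T - 1) ^ k) v) * ((k.factorial : F))⁻¹) * descPochhammer F k, ?_, fun n => ?_⟩
  · refine (degree_sum_le _ _).trans_lt ((Finset.sup_lt_iff (WithBot.bot_lt_coe K)).mpr
      fun k hk => ?_)
    refine degree_le_natDegree.trans_lt (Nat.cast_lt.mpr ?_)
    refine (natDegree_C_mul_le _ _).trans_lt ?_
    rwa [descPochhammer_natDegree, ← Finset.mem_range]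
  · rw [hT, map_sum, eval_finsetSum]
    refine Finset.sum_congr rfl fun k _ => ?_
    rw [eval_C_mul, descPochhammer_eval_eq_descFactorial, Nat.descFactorial_eq_factorial_mul_choose,
      map_smul, smul_eq_mul, Nat.cast_mul]
    have : (k.factorial : F) ≠ 0 := Nat.cast_ne_zero.mpr k.factorial_ne_zero
    field_simp

/-- If `T ^ n v` depends polynomially on `n`, then some power of `T - 1` kills `v`. -/
lemma exists_pow_sub_one_apply_eq_zero [CharZero F] (T : Module.End F V) (v : V) {ι : Type*}
    (s : Finset ι) (p : ι → F[X]) (l : ι → V)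
    (h : ∀ n : ℕ, (T ^ n) v = ∑ i ∈ s, (p i).eval (n : F) • l i) :
    ∃ K : ℕ, ((T - 1) ^ K) v = 0 := by
  -- Applying `T - 1` to the orbit takes a forward difference of the coefficients, and enough
  -- differences kill every polynomial.
  have key : ∀ k n : ℕ, (T ^ n) (((T - 1) ^ k) v) =
      ∑ i ∈ s, ((fwdDiff 1)^[k] (p i).eval) (n : F) • l i := by
    intro k
    induction k with
    | zero => simpa using h
    | succ k ih =>
      intro n
      have h1 : (T ^ n) (((T - 1) ^ (k + 1)) v) =
          (T ^ (n + 1)) (((T - 1) ^ k) v) - (T ^ n) (((T - 1) ^ k) v) := by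
        rw [pow_succ', pow_succ]
        simp
      rw [h1, ih, ih, ← Finset.sum_sub_distrib]
      refine Finset.sum_congr rfl fun i _ => ?_
      rw [Function.iterate_succ_apply', fwdDiff, sub_smul]
      simp
  refine ⟨s.sup (fun i => (p i).natDegree) + 1, ?_⟩
  have := key (s.sup (fun i => (p i).natDegree) + 1) 0
  rw [pow_zero, Module.End.one_apply] at this
  rw [this]
  refine Finset.sum_eq_zero fun i hi => ?_
  rw [Polynomial.fwdDiff_iter_eq_zero_of_degree_lt
    (Nat.lt_succ_of_le (Finset.le_sup (f := fun i => (p i).natDegree) hi))]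
  simp

/-- The exponent needed to kill `v` by powers of `T - 1` is bounded by the dimension of a space
containing the orbit of `v`. -/
lemma pow_finrank_sub_one_apply_eq_zero (T : Module.End F V) (v : V) (W : Submodule F V)
    [Module.Finite F W] (hW : ∀ n : ℕ, (T ^ n) v ∈ W) (h : ∃ K : ℕ, ((T - 1) ^ K) v = 0) :
    ((T - 1) ^ Module.finrank F W) v = 0 := by
  obtain ⟨K, hK⟩ := h
  -- `W` need not be stable under `T`, but the span of the orbit is; on it the kernels of the powers
  -- of `T - 1` stabilize by the dimension.
  let W' := Submodule.span F (Set.range fun n : ℕ => (T ^ n) v)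
  have hW' : W' ≤ W := Submodule.span_le.mpr (by rintro _ ⟨n, rfl⟩; exact hW n)
  have hT : ∀ w ∈ W', T w ∈ W' := fun w hw => by
    induction hw using Submodule.span_induction with
    | mem x hx =>
      obtain ⟨n, rfl⟩ := hx
      exact Submodule.subset_span ⟨n + 1, by simp only [pow_succ', Module.End.mul_apply]⟩
    | zero => simp
    | add x y _ _ hx hy => rw [map_add]; exact add_mem hx hy
    | smul c x _ hx => rw [map_smul]; exact Submodule.smul_mem _ _ hx
  have hD : ∀ w ∈ W', (T - 1) w ∈ W' := fun w hw => sub_mem (hT w hw) hw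
  have hv : v ∈ W' := Submodule.subset_span ⟨0, rfl⟩
  have : Module.Finite F W' := Submodule.finiteDimensional_of_le hW'
  let D : Module.End F W' := (T - 1).restrict hD
  have hpow : ∀ k (w : W'), ((D ^ k) w : V) = ((T - 1) ^ k) w := fun k => by
    induction k with
    | zero => simp
    | succ k ih =>
      intro w
      rw [pow_succ', pow_succ', Module.End.mul_apply, Module.End.mul_apply, ← ih]
      rfl
  have h1 : (⟨v, hv⟩ : W') ∈ LinearMap.ker (D ^ (max K (Module.finrank F W'))) := by
    rw [LinearMap.mem_ker, ← Subtype.coe_inj, hpow]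
    obtain ⟨j, hj⟩ := Nat.exists_eq_add_of_le' (le_max_left K (Module.finrank F W'))
    rw [hj, pow_add, Module.End.mul_apply, hK]
    simp
  rw [Module.End.ker_pow_eq_ker_pow_finrank_of_le (le_max_right _ _), LinearMap.mem_ker,
    ← Subtype.coe_inj, hpow] at h1
  obtain ⟨j, hj⟩ := Nat.exists_eq_add_of_le' (Submodule.finrank_mono hW')
  rw [hj, pow_add, Module.End.mul_apply, h1]
  simp

lemma Polynomial.eq_of_eval_natCast_eq [CharZero F] {p q : F[X]}
    (h : ∀ n : ℕ, p.eval (n : F) = q.eval (n : F)) : p = q :=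
  Polynomial.eq_of_infinite_eval_eq p q
    ((Set.infinite_range_of_injective Nat.cast_injective).mono (by rintro _ ⟨n, rfl⟩; exact h n))

end PolynomialOrbit

namespace AffineGroup

open Polynomial

/-! ### One-parameter subgroups and roots of unipotent points -/

section Unipotent

variable {F A : Type*} [Field F] [CommRing A] [HopfAlgebra F A]

lemma IsUnipotent.conj {u : Points F A} (hu : IsUnipotent u) (y : Points F A) :
    IsUnipotent (y * u * y⁻¹) := by
  intro a
  obtain ⟨n, hn⟩ := hu (translation y⁻¹ a)
  have h : ∀ k : ℕ, (translation (y * u * y⁻¹) - 1) ^ k =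
      translation y * (translation u - 1) ^ k * translation y⁻¹ := fun k => by
    have h1 : translation (y * u * y⁻¹) - 1 =
        translation y * (translation u - 1) * translation y⁻¹ := by
      rw [translation_mul, translation_mul, mul_sub, sub_mul, mul_one, translation_mul_inv]
    rw [h1]
    induction k with
    | zero => simp [translation_mul_inv]
    | succ k ih =>
      rw [pow_succ, ih, pow_succ]
      have := translation_inv_mul y
      calc _ = translation y * (translation u - 1) ^ k * (translation y⁻¹ * translation y) *
            (translation u - 1) * translation y⁻¹ := by noncomm_ring
        _ = _ := by rw [this]; noncomm_ring
  exact ⟨n, by rw [h]; simp [hn]⟩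

lemma continuous_apply_pow [TopologicalSpace F] [IsTopologicalRing F] (n : ℕ) (a : A) :
    Continuous fun x : Points F A => (x ^ n).ofConv a := by
  have h1 : ∀ a, Continuous fun x : Points F A => x.ofConv a := fun a =>
    (continuous_apply a).comp continuous_induced_dom
  induction n generalizing a with
  | zero => simpa using continuous_const
  | succ n ih =>
    have r := Coalgebra.Repr.arbitrary F a
    simp only [pow_succ, mul_apply_eq_sum _ _ r]
    exact continuous_finsetSum _ fun i _ => (ih _).mul (h1 _)

variable [CharZero F]

lemma isUnipotent_of_polynomial {x : Points F A}
    (h : ∀ a, ∃ p : F[X], ∀ n : ℕ, (x ^ n).ofConv a = p.eval (n : F)) : IsUnipotent x := by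
  intro a
  choose p hp using h
  have r := Coalgebra.Repr.arbitrary F a
  refine exists_pow_sub_one_apply_eq_zero _ a r.index (fun i => p (r.right i)) r.left fun n => ?_
  rw [← translation_pow, translation_eq_sum _ r]
  exact Finset.sum_congr rfl fun i _ => by rw [hp]

lemma IsUnipotent.exists_polynomial {x : Points F A} (hx : IsUnipotent x) (a : A) :
    ∃ p : F[X], ∀ n : ℕ, (x ^ n).ofConv a = p.eval (n : F) := by
  obtain ⟨K, hK⟩ := hx a
  obtain ⟨p, -, hp⟩ := exists_polynomial_of_pow_sub_one_apply_eq_zero _ a K hK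
    (Coalgebra.counit (R := F))
  exact ⟨p, fun n => by rw [← hp, ← translation_pow, counit_translation]⟩

/-- For unipotent `u`, the polynomial `p` with `p n = (u ^ n) a`. -/
def IsUnipotent.orbitPoly {u : Points F A} (hu : IsUnipotent u) (a : A) : F[X] :=
  (hu.exists_polynomial a).choose

lemma IsUnipotent.eval_orbitPoly {u : Points F A} (hu : IsUnipotent u) (a : A) (n : ℕ) :
    (hu.orbitPoly a).eval (n : F) = (u ^ n).ofConv a :=
  ((hu.exists_polynomial a).choose_spec n).symm

/-- The one-parameter subgroup through the unipotent point `u`, on regular functions. -/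
def IsUnipotent.orbitHom {u : Points F A} (hu : IsUnipotent u) : A →ₐ[F] F[X] where
  toFun := hu.orbitPoly
  map_one' := eq_of_eval_natCast_eq fun n => by simp [hu.eval_orbitPoly]
  map_zero' := eq_of_eval_natCast_eq fun n => by simp [hu.eval_orbitPoly]
  map_mul' a b := eq_of_eval_natCast_eq fun n => by simp [hu.eval_orbitPoly]
  map_add' a b := eq_of_eval_natCast_eq fun n => by simp [hu.eval_orbitPoly]
  commutes' c := eq_of_eval_natCast_eq fun n => by simp [hu.eval_orbitPoly]

lemma IsUnipotent.eval_orbitHom {u : Points F A} (hu : IsUnipotent u) (a : A) (n : ℕ) :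
    (hu.orbitHom a).eval (n : F) = (u ^ n).ofConv a :=
  hu.eval_orbitPoly a n

/-- The power `u ^ t` of a unipotent point `u`, for `t` in the base field. -/
def IsUnipotent.fieldPow {u : Points F A} (hu : IsUnipotent u) (t : F) : Points F A :=
  WithConv.toConv ((aeval t).comp hu.orbitHom)

lemma IsUnipotent.fieldPow_apply {u : Points F A} (hu : IsUnipotent u) (t : F) (a : A) :
    (hu.fieldPow t).ofConv a = (hu.orbitHom a).eval t := by
  rw [← coe_aeval_eq_eval]
  rfl

lemma IsUnipotent.fieldPow_natCast {u : Points F A} (hu : IsUnipotent u) (n : ℕ) :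
    hu.fieldPow n = u ^ n := by
  ext a
  rw [hu.fieldPow_apply, hu.eval_orbitHom]

lemma IsUnipotent.fieldPow_add {u : Points F A} (hu : IsUnipotent u) (t t' : F) :
    hu.fieldPow (t + t') = hu.fieldPow t * hu.fieldPow t' := by
  ext a
  have r := Coalgebra.Repr.arbitrary F a
  rw [mul_apply_eq_sum _ _ r]
  simp only [hu.fieldPow_apply]
  -- The identity passes from natural to arbitrary exponents one variable at a time, the second
  -- exponent first.
  have h1 : ∀ n : ℕ, (hu.orbitHom a).comp (C (n : F) + X) =
      ∑ i ∈ r.index, C ((hu.orbitHom (r.left i)).eval (n : F)) * hu.orbitHom (r.right i) := by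
    refine fun n => eq_of_eval_natCast_eq fun k => ?_
    have : ((n : F) + k) = ((n + k : ℕ) : F) := by push_cast; rfl
    simp only [eval_comp, eval_add, eval_C, eval_X, eval_finsetSum, eval_mul, this,
      hu.eval_orbitHom, pow_add, mul_apply_eq_sum _ _ r]
  have h2 : (hu.orbitHom a).comp (X + C t') =
      ∑ i ∈ r.index, hu.orbitHom (r.left i) * C ((hu.orbitHom (r.right i)).eval t') := by
    refine eq_of_eval_natCast_eq fun n => ?_
    have := congrArg (eval t') (h1 n)
    simpa [eval_comp, eval_finsetSum] using this
  simpa [eval_comp, eval_finsetSum] using congrArg (eval t) h2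

lemma IsUnipotent.fieldPow_pow {u : Points F A} (hu : IsUnipotent u) (t : F) (n : ℕ) :
    hu.fieldPow t ^ n = hu.fieldPow (n * t) := by
  induction n with
  | zero => simpa using (hu.fieldPow_natCast 0).symm
  | succ n ih => rw [pow_succ, ih, ← hu.fieldPow_add]; push_cast; ring_nf

lemma IsUnipotent.isUnipotent_fieldPow {u : Points F A} (hu : IsUnipotent u) (t : F) :
    IsUnipotent (hu.fieldPow t) :=
  isUnipotent_of_polynomial fun a => ⟨(hu.orbitHom a).comp (X * C t), fun n => by
    rw [hu.fieldPow_pow, hu.fieldPow_apply, mul_comm]; simp⟩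

/-- The orbit polynomials of `u` and `v` agree at all multiples of `m`, hence everywhere, in
particular at `1`. -/
lemma IsUnipotent.eq_of_pow_eq {u v : Points F A} (hu : IsUnipotent u) (hv : IsUnipotent v)
    {m : ℕ} (hm : m ≠ 0) (h : u ^ m = v ^ m) : u = v := by
  have hm' : (m : F) ≠ 0 := Nat.cast_ne_zero.mpr hm
  ext a
  have h1 : (hu.orbitHom a).comp (C (m : F) * X) = (hv.orbitHom a).comp (C (m : F) * X) := by
    refine eq_of_eval_natCast_eq fun n => ?_
    have : ((m : F) * n) = ((m * n : ℕ) : F) := by push_cast; rfl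
    simp only [eval_comp, eval_mul, eval_C, eval_X, this, eval_orbitHom, pow_mul, h]
  have h2 := congrArg (eval (m : F)⁻¹) h1
  simp only [eval_comp, eval_mul, eval_C, eval_X, mul_inv_cancel₀ hm'] at h2
  have h3 := hu.eval_orbitHom a 1
  have h4 := hv.eval_orbitHom a 1
  rw [Nat.cast_one, pow_one] at h3 h4
  rw [← h3, ← h4, h2]

/-- The `m`-th root of a unipotent point. -/
def unipRoot (m : ℕ) (u : unip F A) : unip F A :=
  ⟨IsUnipotent.fieldPow u.2 (m : F)⁻¹, IsUnipotent.isUnipotent_fieldPow u.2 _⟩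

lemma unipRoot_pow {m : ℕ} (hm : m ≠ 0) (u : unip F A) : (unipRoot m u : Points F A) ^ m = u := by
  have hm' : (m : F) ≠ 0 := Nat.cast_ne_zero.mpr hm
  have h : IsUnipotent (u : Points F A) := u.2
  change h.fieldPow (m : F)⁻¹ ^ m = u
  have h1 := h.fieldPow_natCast 1
  rw [Nat.cast_one, pow_one] at h1
  rw [h.fieldPow_pow, mul_inv_cancel₀ hm', h1]

lemma unipRoot_eq {m : ℕ} (hm : m ≠ 0) {u v : unip F A} (h : (v : Points F A) ^ m = u) :
    unipRoot m u = v :=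
  Subtype.ext (IsUnipotent.eq_of_pow_eq (unipRoot m u).2 v.2 hm (by rw [unipRoot_pow hm, h]))

/-- A function in `I` vanishes at all powers of `u`, so its orbit polynomial is zero and vanishes at
`1 / m` too. -/
lemma unipRoot_mem_subgroupPoints (m : ℕ) (I : Ideal A) [I.IsHopfIdeal F] (u : unip F A)
    (hu : (u : Points F A) ∈ subgroupPoints (F := F) I) :
    (unipRoot m u : Points F A) ∈ subgroupPoints (F := F) I := by
  have h : IsUnipotent (u : Points F A) := u.2
  intro a ha
  change (h.fieldPow (m : F)⁻¹).ofConv a = 0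
  have h0 : h.orbitHom a = 0 := eq_of_eval_natCast_eq fun n => by
    rw [h.eval_orbitHom, eval_zero]
    exact (subgroupPoints (F := F) I).pow_mem hu n a ha
  rw [h.fieldPow_apply, h0, eval_zero]

section Topology

variable [TopologicalSpace F] [IsTopologicalRing F]

/-- The translates of `a` lie in one space of dimension `K`, so for every `u` the orbit polynomial
has degree below `K`. Lagrange interpolation at `0, …, K - 1` then writes the value at `1 / m` as a
fixed linear combination of the continuous functions `u ↦ a (u ^ i)`. -/
lemma continuous_unipRoot (m : ℕ) : Continuous (unipRoot (F := F) (A := A) m) := by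
  refine Continuous.subtype_mk (continuous_induced_rng.mpr (continuous_pi fun a => ?_)) _
  obtain ⟨W, hW, hWa⟩ := exists_finite_translation_mem (F := F) a
  let K := Module.finrank F W
  have key : ∀ u : unip F A, ((unipRoot m u : Points F A)).ofConv a =
      ∑ i ∈ Finset.range K, ((u : Points F A) ^ i).ofConv a *
        (Lagrange.basis (Finset.range K) (fun i : ℕ => (i : F)) i).eval (m : F)⁻¹ := fun u => by
    have h : IsUnipotent (u : Points F A) := u.2
    obtain ⟨p, hpK, hp⟩ := exists_polynomial_of_pow_sub_one_apply_eq_zero _ a K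
      (pow_finrank_sub_one_apply_eq_zero (translation (u : Points F A)) a W
        (fun n => by rw [← translation_pow]; exact hWa _) (h a)) (Coalgebra.counit (R := F))
    have hp' : ∀ n : ℕ, p.eval (n : F) = ((u : Points F A) ^ n).ofConv a := fun n => by
      rw [← hp, ← translation_pow, counit_translation]
    have h1 : h.orbitHom a = p := eq_of_eval_natCast_eq fun n => by rw [h.eval_orbitHom, hp']
    have h2 := Lagrange.eq_interpolate_of_eval_eq (s := Finset.range K) (f := p)
      (v := fun i : ℕ => (i : F)) (fun i => ((u : Points F A) ^ i).ofConv a)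
      Nat.cast_injective.injOn (by simpa using hpK) (fun i _ => hp' i)
    change (h.fieldPow (m : F)⁻¹).ofConv a = _
    rw [h.fieldPow_apply, h1, h2, Lagrange.interpolate_apply, eval_finsetSum]
    simp
  change Continuous fun u : unip F A => ((unipRoot m u : Points F A)).ofConv a
  simp only [key]
  exact continuous_finsetSum _ fun i _ =>
    ((continuous_apply_pow i a).comp continuous_subtype_val).mul continuous_const

end Topology

end Unipotent

end AffineGroup

universe u v

/-! ### Central extensions of nilpotent groups with bijective power map -/

section CentralExtension

/-- In a group where `m`-th powers are bijective, an element commuting with `g ^ m` commutes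
with `g`. -/
lemma commute_of_commute_pow {G : Type*} [Group G] {m : ℕ}
    (hG : Function.Injective fun g : G => g ^ m) {g h : G} (hgh : Commute (g ^ m) h) :
    Commute g h := by
  have : (h * g * h⁻¹) ^ m = g ^ m := by
    rw [conj_pow, ← hgh.eq, mul_inv_cancel_right]
  have := hG this
  exact (mul_inv_eq_iff_eq_mul.mp this).symm

/-- The `m`-th power of a lift only depends on the element lifted. -/
lemma pow_eq_pow_of_map_eq {E G : Type*} [Group E] [Group G] {m : ℕ} {p : E →* G}
    (hker : ∀ e, p e = 1 → e ^ m = 1 ∧ ∀ y, Commute e y) {e e' : E} (h : p e = p e') :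
    e ^ m = e' ^ m := by
  have h1 : p (e * e'⁻¹) = 1 := by rw [map_mul, map_inv, h, mul_inv_cancel]
  have h2 : e = (e * e'⁻¹) * e' := by group
  rw [h2, ((hker _ h1).2 e').mul_pow, (hker _ h1).1, one_mul]

/-- For injectivity, if `x ^ m` and `y ^ m` differ by a central element, its `m`-th root `w` is
again central, whence `(x * w) ^ m = y ^ m` and `y = x * w`. -/
lemma pow_bijective_quotient_center {G : Type*} [Group G] {m : ℕ}
    (hG : Function.Bijective fun g : G => g ^ m) :
    Function.Bijective fun g : G ⧸ Subgroup.center G => g ^ m := by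
  constructor
  · intro x y
    induction x using QuotientGroup.induction_on with | _ x
    induction y using QuotientGroup.induction_on with | _ y
    intro h
    have h' : ((x ^ m : G) : G ⧸ Subgroup.center G) = ((y ^ m : G) : G ⧸ _) := h
    rw [QuotientGroup.eq] at h' ⊢
    obtain ⟨w, hw⟩ := hG.2 ((x ^ m)⁻¹ * y ^ m)
    have hwc : w ∈ Subgroup.center G := Subgroup.mem_center_iff.mpr fun g =>
      (commute_of_commute_pow hG.1 (by
        simp only at hw
        rw [hw]
        exact (Subgroup.mem_center_iff.mp h' g).symm)).eq.symm
    have : x * w = y := hG.1 (by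
      have hc : Commute x w := Subgroup.mem_center_iff.mp hwc x
      simp only at hw ⊢
      rw [hc.mul_pow, hw, mul_inv_cancel_left])
    rwa [← this, inv_mul_cancel_left]
  · intro y
    induction y using QuotientGroup.induction_on with | _ y
    obtain ⟨x, rfl⟩ := hG.2 y
    exact ⟨x, rfl⟩

/-- A section of a central extension of a nilpotent group on which `m`-th powers are bijective,
whose kernel has exponent `m` and whose values are `m`-th powers, is a homomorphism. -/
theorem section_mul_of_isNilpotent {G : Type u} [Group G] [Group.IsNilpotent G] {m : ℕ}
    (hG : Function.Bijective fun g : G => g ^ m) {E : Type v} [Group E] (p : E →* G)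
    (hp : Function.Surjective p) (hker : ∀ e, p e = 1 → e ^ m = 1 ∧ ∀ y, Commute e y)
    (s : G → E) (hs : ∀ e, s (p e ^ m) = e ^ m) (g h : G) : s (g * h) = s g * s h := by
  revert E
  revert g h
  -- The induction must range over all extensions, because the inductive step replaces `E` by a
  -- quotient.
  refine Group.nilpotent_center_quotient_ind (P := fun G _ _ =>
    Function.Bijective (fun g : G => g ^ m) → ∀ g h : G, ∀ {E : Type v} [Group E] (p : E →* G),
      Function.Surjective p → (∀ e, p e = 1 → e ^ m = 1 ∧ ∀ y, Commute e y) →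
      ∀ s : G → E, (∀ e, s (p e ^ m) = e ^ m) → s (g * h) = s g * s h) G ?_ ?_ hG
  · intro G _ _ hG g h E _ p hp hker s hs
    have h1 : s 1 = 1 := by simpa using hs 1
    rw [Subsingleton.elim g 1, Subsingleton.elim h 1]
    simp [h1]
  · intro G _ _ ih hG g h E _ p hp hker s hs
    have hps : ∀ g, p (s g) = g := fun g => by
      obtain ⟨g, rfl⟩ := hG.2 g
      obtain ⟨e, rfl⟩ := hp g
      simp only [hs, map_pow]
    have hconj : ∀ y g, y * s g * y⁻¹ = s (p y * g * (p y)⁻¹) := fun y g => by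
      obtain ⟨g, rfl⟩ := hG.2 g
      obtain ⟨e, rfl⟩ := hp g
      have := hs (y * e * y⁻¹)
      simp only [map_mul, map_inv, conj_pow] at this
      simp only [hs, this]
    have hmul : ∀ g h, Commute g h → s (g * h) = s g * s h := fun g h hgh => by
      obtain ⟨g, rfl⟩ := hG.2 g
      obtain ⟨h, rfl⟩ := hG.2 h
      have hgh' : Commute g h := commute_of_commute_pow hG.1
        (commute_of_commute_pow hG.1 hgh.symm).symm
      have hc : Commute (s g) (s h) := by
        have := hconj (s g) h
        rw [hps, hgh'.eq, mul_inv_cancel_right] at this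
        exact mul_inv_eq_iff_eq_mul.mp this
      have h1 := hs (s g * s h)
      have h2 := hs (s g)
      have h3 := hs (s h)
      rw [map_mul, hps, hps, hgh'.mul_pow, hc.mul_pow] at h1
      rw [hps] at h2 h3
      simp only [h1, h2, h3]
    let Z := Subgroup.center G
    have hsZ : ∀ z ∈ Z, ∀ y, Commute (s z) y := fun z hz y => by
      have := hconj y z
      rw [Subgroup.mem_center_iff.mp hz, mul_inv_cancel_right] at this
      exact (mul_inv_eq_iff_eq_mul.mp this).symm
    have hZ1 : s 1 = 1 := by simpa using hs 1
    -- The section embeds the centre `Z` as a central subgroup `N` of `E`, so that `E ⧸ N → G ⧸ Z`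
    -- is an extension of the same kind.
    let N : Subgroup E :=
      { carrier := s '' Z
        one_mem' := ⟨1, Z.one_mem, hZ1⟩
        mul_mem' := by
          rintro _ _ ⟨a, ha, rfl⟩ ⟨b, hb, rfl⟩
          exact ⟨a * b, Z.mul_mem ha hb, hmul a b (Subgroup.mem_center_iff.mp hb a)⟩
        inv_mem' := by
          rintro _ ⟨a, ha, rfl⟩
          refine ⟨a⁻¹, Z.inv_mem ha, ?_⟩
          rw [eq_inv_iff_mul_eq_one, ← hmul _ _ (Commute.inv_left rfl), inv_mul_cancel, hZ1] }
    have hN : N.Normal := ⟨by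
      rintro _ ⟨a, ha, rfl⟩ g
      rw [← (hsZ a ha g).eq, mul_inv_cancel_right]
      exact ⟨a, ha, rfl⟩⟩
    let q : E ⧸ N →* G ⧸ Z := QuotientGroup.map N Z p (by
      rintro _ ⟨a, ha, rfl⟩
      change p (s a) ∈ Z
      rwa [hps])
    have hq : Function.Surjective q := fun x => by
      induction x using QuotientGroup.induction_on with | _ x
      obtain ⟨e, rfl⟩ := hp x
      exact ⟨e, rfl⟩
    have hqker : ∀ e, q e = 1 → e ^ m = 1 ∧ ∀ y, Commute e y := fun e he => by
      induction e using QuotientGroup.induction_on with | _ e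
      have he' : p e ∈ Z := (QuotientGroup.eq_one_iff _).mp he
      -- Modulo `N`, a class in the kernel of `q` is represented by an element of the kernel of `p`.
      have h1 : p (e * (s (p e))⁻¹) = 1 := by rw [map_mul, map_inv, hps, mul_inv_cancel]
      have h2 : (e : E ⧸ N) = ((e * (s (p e))⁻¹ : E) : E ⧸ N) := by
        rw [QuotientGroup.eq, inv_mul_cancel_left]
        exact N.inv_mem ⟨_, he', rfl⟩
      obtain ⟨h3, h4⟩ := hker _ h1
      rw [h2]
      refine ⟨?_, fun y => ?_⟩
      · rw [← QuotientGroup.mk_pow, h3]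
        rfl
      · induction y using QuotientGroup.induction_on with | _ y
        exact congrArg (QuotientGroup.mk (s := N)) (h4 y).eq
    have hsq : ∀ a b : G, (a : G ⧸ Z) = b → (s a : E ⧸ N) = s b := fun a b hab => by
      rw [QuotientGroup.eq] at hab
      have : b = a * (a⁻¹ * b) := by group
      rw [this, hmul _ _ (Subgroup.mem_center_iff.mp hab a), QuotientGroup.eq, inv_mul_cancel_left]
      exact ⟨_, hab, rfl⟩
    let s' : G ⧸ Z → E ⧸ N := Quotient.lift (fun a => (s a : E ⧸ N)) fun a b hab =>
      hsq a b (Quotient.sound hab)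
    have hs' : ∀ e, s' (q e ^ m) = e ^ m := fun e => by
      induction e using QuotientGroup.induction_on with | _ e
      exact congrArg (QuotientGroup.mk (s := N)) (hs e)
    -- By induction the two sides differ by some `s z` with `z` central; applying `p` gives `z = 1`.
    have key : ((s (g * h) : E) : E ⧸ N) = ((s g * s h : E) : E ⧸ N) :=
      ih (pow_bijective_quotient_center hG) g h q hq hqker s' hs'
    rw [QuotientGroup.eq] at key
    obtain ⟨z, hz, hz'⟩ := key
    have h1 := congrArg p hz'
    rw [hps, map_mul, map_inv, map_mul, hps, hps, hps, inv_mul_cancel] at h1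
    rw [h1, hZ1] at hz'
    exact inv_mul_eq_one.mp hz'.symm

end CentralExtension

/-! ### A nilpotency criterion for linear groups -/

section NilpotentOfProducts

open scoped Pointwise in
/-- A group with a faithful representation `ρ` such that all products of `N` factors `ρ g - 1`
vanish is nilpotent. -/
theorem Group.isNilpotent_of_prod_sub_one_eq_zero {F G R : Type*} [Field F] [Group G] [Ring R]
    [Algebra F R] (ρ : G →* R) (hρ : Function.Injective ρ) (N : ℕ)
    (h : ∀ l : List G, l.length = N → (l.map fun g => ρ g - 1).prod = 0) :
    Group.IsNilpotent G := by
  -- `J` is the image of the augmentation ideal of the group algebra.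
  let J : Submodule F R := Submodule.span F (Set.range fun g => ρ g - 1)
  have hJ : ∀ g, ρ g - 1 ∈ J := fun g => Submodule.subset_span ⟨g, rfl⟩
  have hJN : J ^ N = ⊥ := by
    rw [Submodule.span_pow, Submodule.span_eq_bot]
    intro r hr
    rw [Set.mem_pow] at hr
    obtain ⟨f, rfl⟩ := hr
    have hf : ∀ i, ∃ g, ρ g - 1 = f i := fun i => (f i).2
    choose g hg using hf
    have := h (List.ofFn g) (List.length_ofFn)
    rw [List.map_ofFn] at this
    rw [← this]
    congr 2
    funext i
    exact (hg i).symm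
  have hJJ : J * J ≤ J := by
    rw [Submodule.span_mul_span, Submodule.span_le]
    rintro _ ⟨_, ⟨g, rfl⟩, _, ⟨k, rfl⟩, rfl⟩
    have : (ρ g - 1) * (ρ k - 1) = (ρ (g * k) - 1) - (ρ g - 1) - (ρ k - 1) := by
      rw [map_mul]; noncomm_ring
    simp only [this]
    exact sub_mem (sub_mem (hJ _) (hJ _)) (hJ _)
  have hle : ∀ n, J ^ (n + 1 + 1) ≤ J ^ (n + 1) := fun n => by
    induction n with
    | zero => simpa [pow_two] using hJJ
    | succ n ih => rw [pow_succ J (n + 1 + 1), pow_succ J (n + 1)]; exact mul_le_mul' ih le_rfl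
  have hr : ∀ n r g, r ∈ J ^ (n + 1) → r * ρ g ∈ J ^ (n + 1) := fun n r g hr => by
    have : r * ρ g = r * (ρ g - 1) + r := by noncomm_ring
    rw [this]
    exact add_mem (hle n (by rw [pow_succ]; exact Submodule.mul_mem_mul hr (hJ g))) hr
  -- The exponent is `n + 1` so that `H 0` is the whole group; `H N` is trivial because `J ^ N = ⊥`
  -- and `ρ` is faithful.
  let H : ℕ → Subgroup G := fun n =>
    { carrier := {g | ρ g - 1 ∈ J ^ (n + 1)}
      one_mem' := by simp
      mul_mem' := fun {a b} ha hb => by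
        have : ρ (a * b) - 1 = (ρ a - 1) * ρ b + (ρ b - 1) := by rw [map_mul]; noncomm_ring
        change ρ (a * b) - 1 ∈ J ^ (n + 1)
        rw [this]
        exact add_mem (hr _ _ _ ha) hb
      inv_mem' := fun {a} ha => by
        have h1 : ρ a * ρ a⁻¹ = 1 := by rw [← map_mul, mul_inv_cancel, map_one]
        have : ρ a⁻¹ - 1 = -((ρ a - 1) * ρ a⁻¹) := by rw [sub_mul, h1]; noncomm_ring
        change ρ a⁻¹ - 1 ∈ J ^ (n + 1)
        rw [this]
        exact neg_mem (hr _ _ _ ha) }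
  rw [Subgroup.nilpotent_iff_finite_descending_central_series]
  refine ⟨N, H, ⟨?_, fun x n hx g => ?_⟩, ?_⟩
  · refine top_le_iff.mp fun g _ => ?_
    change ρ g - 1 ∈ J ^ 1
    rw [pow_one]
    exact hJ g
  · have hx' : ρ x - 1 ∈ J ^ (n + 1) := hx
    have h1 : ρ x * ρ x⁻¹ = 1 := by rw [← map_mul, mul_inv_cancel, map_one]
    have h2 : ρ g * ρ g⁻¹ = 1 := by rw [← map_mul, mul_inv_cancel, map_one]
    have h3 : ρ (x * g * x⁻¹ * g⁻¹) - 1 =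
        ((ρ x - 1) * (ρ g - 1) - (ρ g - 1) * (ρ x - 1)) * ρ x⁻¹ * ρ g⁻¹ := by
      have h4 : (ρ x - 1) * (ρ g - 1) - (ρ g - 1) * (ρ x - 1) = ρ x * ρ g - ρ g * ρ x := by
        noncomm_ring
      rw [h4, sub_mul, sub_mul, mul_assoc (ρ g), h1, mul_one, h2]
      simp only [map_mul]
    change ρ (x * g * x⁻¹ * g⁻¹) - 1 ∈ J ^ (n + 1 + 1)
    rw [h3]
    refine hr _ _ _ (hr _ _ _ (sub_mem ?_ ?_))
    · rw [pow_succ]; exact Submodule.mul_mem_mul hx' (hJ g)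
    · rw [pow_succ']; exact Submodule.mul_mem_mul (hJ g) hx'
  · refine (Subgroup.eq_bot_iff_forall _).mpr fun g hg => ?_
    have hg' : ρ g - 1 ∈ J ^ (N + 1) := hg
    rw [pow_succ, hJN, Submodule.bot_mul, Submodule.mem_bot, sub_eq_zero] at hg'
    exact hρ (by rw [hg', map_one])

end NilpotentOfProducts

namespace AffineGroup

/-! ### Matrix representations of unipotent group schemes -/

section MatrixRep

variable {F B : Type*} [Field F] [CommRing B] [HopfAlgebra F B]

/-- The quotient of a matrix representation by a fixed vector `v` with `v i₀ ≠ 0`. -/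
def quotientRep {n : ℕ} (c : Matrix (Fin (n + 1)) (Fin (n + 1)) B) (v : Fin (n + 1) → F)
    (i₀ : Fin (n + 1)) : Matrix (Fin n) (Fin n) B :=
  .of fun i j => c (i₀.succAbove i) (i₀.succAbove j) -
    (v (i₀.succAbove i) / v i₀) • c i₀ (i₀.succAbove j)

lemma quotientRep_apply {n : ℕ} (c : Matrix (Fin (n + 1)) (Fin (n + 1)) B) (v : Fin (n + 1) → F)
    (i₀ : Fin (n + 1)) (i j : Fin n) : quotientRep c v i₀ i j =
      c (i₀.succAbove i) (i₀.succAbove j) -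
        (v (i₀.succAbove i) / v i₀) • c i₀ (i₀.succAbove j) := rfl

/-- Modulo `v`, the basis vector of index `i₀` is a combination of the others with coefficients `- v
k / v i₀`; this is the resulting relation for its column. -/
lemma quotientRep_sum {n : ℕ} {c : Matrix (Fin (n + 1)) (Fin (n + 1)) B}
    {v : Fin (n + 1) → F} {i₀ : Fin (n + 1)} (hv : v i₀ ≠ 0)
    (hcv : ∀ i, ∑ j, v j • c i j = algebraMap F B (v i)) (i : Fin n) :
    c (i₀.succAbove i) i₀ - (v (i₀.succAbove i) / v i₀) • c i₀ i₀ =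
      - ∑ k, (v (i₀.succAbove k) / v i₀) • quotientRep c v i₀ i k := by
  have h1 := hcv (i₀.succAbove i)
  have h2 := hcv i₀
  rw [Fin.sum_univ_succAbove _ i₀] at h1 h2
  have h3 : ∑ k, (v (i₀.succAbove k) / v i₀) • quotientRep c v i₀ i k =
      (v i₀)⁻¹ • (∑ k, v (i₀.succAbove k) • c (i₀.succAbove i) (i₀.succAbove k)) -
      ((v i₀)⁻¹ * (v (i₀.succAbove i) / v i₀)) •
        ∑ k, v (i₀.succAbove k) • c i₀ (i₀.succAbove k) := by
    rw [Finset.smul_sum, Finset.smul_sum, ← Finset.sum_sub_distrib]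
    refine Finset.sum_congr rfl fun k _ => ?_
    rw [quotientRep_apply, smul_sub, smul_smul, smul_smul, smul_smul]
    congr 2 <;> ring
  rw [h3, eq_sub_of_add_eq' h1, eq_sub_of_add_eq' h2, smul_sub, smul_sub, smul_smul, smul_smul,
    inv_mul_cancel₀ hv, one_smul, Algebra.algebraMap_eq_smul_one, Algebra.algebraMap_eq_smul_one,
    smul_smul, smul_smul]
  have h4 : (v i₀)⁻¹ * (v (i₀.succAbove i) / v i₀) * v i₀ = (v i₀)⁻¹ * v (i₀.succAbove i) := by
    field_simp
  have h5 : (v i₀)⁻¹ * (v (i₀.succAbove i) / v i₀) * v i₀ = v (i₀.succAbove i) / v i₀ := by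
    field_simp
  rw [h5, ← h4, h5]
  abel

lemma IsMatrixRep.quotientRep {n : ℕ} {c : Matrix (Fin (n + 1)) (Fin (n + 1)) B}
    (hc : IsMatrixRep (F := F) c) {v : Fin (n + 1) → F} {i₀ : Fin (n + 1)} (hv : v i₀ ≠ 0)
    (hcv : ∀ i, ∑ j, v j • c i j = algebraMap F B (v i)) :
    IsMatrixRep (F := F) (quotientRep c v i₀) where
  comul_apply i j := by
    have h1 : Coalgebra.comul (R := F) (AffineGroup.quotientRep c v i₀ i j) =
        ∑ k, (c (i₀.succAbove i) k - (v (i₀.succAbove i) / v i₀) • c i₀ k) ⊗ₜ[F]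
          c k (i₀.succAbove j) := by
      rw [quotientRep_apply, map_sub, map_smul, hc.comul_apply, hc.comul_apply,
        Finset.smul_sum, ← Finset.sum_sub_distrib]
      refine Finset.sum_congr rfl fun k _ => ?_
      rw [TensorProduct.sub_tmul, TensorProduct.smul_tmul']
    rw [h1, Fin.sum_univ_succAbove _ i₀, quotientRep_sum hv hcv, TensorProduct.neg_tmul,
      TensorProduct.sum_tmul, neg_add_eq_sub, ← Finset.sum_sub_distrib]
    refine Finset.sum_congr rfl fun k _ => ?_
    change AffineGroup.quotientRep c v i₀ i k ⊗ₜ[F] c (i₀.succAbove k) (i₀.succAbove j) - _ = _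
    rw [TensorProduct.smul_tmul, ← TensorProduct.tmul_sub]
    rfl
  counit_apply i j := by
    rw [quotientRep_apply, map_sub, map_smul, hc.counit_apply, hc.counit_apply]
    simp [Fin.ne_succAbove]

/-- Products of `n` operators `x - 1`, for `x` in an `n`-dimensional representation of a unipotent
group, vanish. -/
theorem IsUnipotentGroup.prod_sub_one_eq_zero (hB : IsUnipotentGroup F B) :
    ∀ (n : ℕ) (c : Matrix (Fin n) (Fin n) B), IsMatrixRep (F := F) c →
    ∀ l : List (B →ₐ[F] F), l.length = n → (l.map fun x : B →ₐ[F] F => c.map x - 1).prod = 0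
  | 0, _, _, _, _ => Subsingleton.elim _ _
  | n + 1, c, hc, [], hl => by simp at hl
  | n + 1, c, hc, x :: l, hl => by
    obtain ⟨v, hv0, hcv⟩ := hB (n + 1) c n.succ_pos hc
    obtain ⟨i₀, hv⟩ := Function.ne_iff.mp hv0
    have hv : v i₀ ≠ 0 := hv
    have hd := hB.prod_sub_one_eq_zero n _ (hc.quotientRep hv hcv) l (by simpa using hl)
    -- The matrix of the projection onto the quotient by `v`.
    let Q : Matrix (Fin n) (Fin (n + 1)) F := .of fun i k =>
      (if i₀.succAbove i = k then 1 else 0) - (v (i₀.succAbove i) / v i₀) * if i₀ = k then 1 else 0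
    have hQ : ∀ (m : Matrix (Fin (n + 1)) (Fin (n + 1)) F) i j, (Q * m) i j =
        m (i₀.succAbove i) j - (v (i₀.succAbove i) / v i₀) * m i₀ j := fun m i j => by
      rw [Matrix.mul_apply]
      simp only [Q, Matrix.of_apply, sub_mul, Finset.sum_sub_distrib, mul_assoc]
      simp
    have hQc : ∀ x : B →ₐ[F] F, Q * (c.map x - 1) = ((quotientRep c v i₀).map x - 1) * Q := by
      intro x
      rw [Matrix.mul_sub, Matrix.sub_mul, Matrix.mul_one, Matrix.one_mul]
      congr 1
      ext i k
      rw [hQ]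
      have h2 := congrArg x (quotientRep_sum hv hcv i)
      simp only [map_sub, map_neg, map_sum, map_smul, smul_eq_mul] at h2
      rcases Fin.eq_self_or_eq_succAbove i₀ k with rfl | ⟨j, rfl⟩
      · simp only [Matrix.map_apply, h2, Matrix.mul_apply, Matrix.of_apply, Q,
          Fin.succAbove_ne, if_false, if_true,
          mul_one, zero_sub, mul_neg, Finset.sum_neg_distrib]
        simp only [mul_comm]
      · simp [Matrix.mul_apply, Q, quotientRep, Fin.ne_succAbove]
    have hQl : ∀ l : List (B →ₐ[F] F), Q * (l.map fun x : B →ₐ[F] F => c.map x - 1).prod =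
        (l.map fun x : B →ₐ[F] F => (quotientRep c v i₀).map x - 1).prod * Q := fun l => by
      induction l with
      | nil => simp
      | cons y l ih =>
        rw [List.map_cons, List.prod_cons, List.map_cons, List.prod_cons, ← Matrix.mul_assoc, hQc,
          Matrix.mul_assoc, ih, Matrix.mul_assoc]
    have hP := hQl l
    rw [hd, Matrix.zero_mul] at hP
    rw [List.map_cons, List.prod_cons]
    set P := (l.map fun x : B →ₐ[F] F => c.map x - 1).prod
    -- By induction the product of the last `n` factors is zero on the quotient, so its columns are
    -- multiples of `v`, which the remaining factor `x - 1` kills.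
    have hP' : ∀ i j, P i j = v i * (P i₀ j / v i₀) := fun i j => by
      rcases Fin.eq_self_or_eq_succAbove i₀ i with rfl | ⟨i, rfl⟩
      · field_simp
      · have := congrFun (congrFun hP i) j
        rw [hQ, Matrix.zero_apply, sub_eq_zero] at this
        rw [this]; ring
    ext i j
    rw [sub_mul, one_mul, Matrix.sub_apply, Matrix.zero_apply, Matrix.mul_apply, sub_eq_zero]
    have h3 := congrArg x (hcv i)
    simp only [map_sum, map_smul, smul_eq_mul, AlgHom.commutes, Algebra.algebraMap_self_apply] at h3
    rw [hP' i j, ← h3, Finset.sum_mul]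
    refine Finset.sum_congr rfl fun k _ => ?_
    rw [hP' k j, Matrix.map_apply]
    ring

/-- Every element of a Hopf algebra is a combination of matrix coefficients. -/
theorem exists_isMatrixRep_mem_span (a : B) : ∃ (n : ℕ) (c : Matrix (Fin n) (Fin n) B),
    IsMatrixRep (F := F) c ∧
      a ∈ Submodule.span F (Set.range fun p : Fin n × Fin n => c p.1 p.2) := by
  let 𝒞 := Module.Basis.ofVectorSpace F B
  obtain ⟨b, hb⟩ := TensorProduct.eq_repr_basis_right 𝒞 (Coalgebra.comul (R := F) a)
  -- The left components of the coproduct of `a` span a finite-dimensional subcomodule containing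
  -- `a`.
  let W := Submodule.span F (b '' b.support)
  have hW : Module.Finite F W := Module.Finite.span_of_finite F (b.support.finite_toSet.image _)
  have hbW : ∀ i ∈ b.support, b i ∈ W := fun i hi =>
    Submodule.subset_span (Set.mem_image_of_mem _ hi)
  have hΔ : ∀ w ∈ W, Coalgebra.comul (R := F) w ∈ LinearMap.range (W.subtype.rTensor B) := by
    intro w hw
    induction hw using Submodule.span_induction with
    | mem x hx =>
      obtain ⟨i, _, rfl⟩ := hx
      -- An equivariant operator taking `a` to `b i`: the coproduct of `b i` then arises from that
      -- of `a` by changing right components only.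
      let T : Module.End F B :=
        (TensorProduct.rid F B).toLinearMap ∘ₗ (𝒞.coord i).lTensor B ∘ₗ Coalgebra.comul
      have hT : T a = b i := by
        simp only [T, LinearMap.comp_apply, ← hb, Finsupp.sum, map_sum, LinearMap.lTensor_tmul]
        rw [Finset.sum_eq_single i]
        · simp
        · intro j _ hj
          simp [hj]
        · intro hi
          simp [Finsupp.notMem_support_iff.mp hi]
      have h1 : Coalgebra.comul (R := F) (T a) = T.lTensor B (Coalgebra.comul (R := F) a) :=
        LinearMap.congr_fun (isEquivariant_rid_lTensor (𝒞.coord i)) a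
      rw [← hT, h1, ← hb, Finsupp.sum, map_sum]
      refine Submodule.sum_mem _ fun j hj => ⟨⟨b j, hbW j hj⟩ ⊗ₜ T (𝒞 j), ?_⟩
      simp
    | zero => simp
    | add x y _ _ hx hy => rw [map_add]; exact add_mem hx hy
    | smul c x _ hx => rw [map_smul]; exact Submodule.smul_mem _ _ hx
  let w := Module.finBasis F W
  have hc : ∀ j, ∃ c : Fin (Module.finrank F W) → B,
      Coalgebra.comul (R := F) (w j : B) = ∑ i, (w i : B) ⊗ₜ[F] c i := by
    intro j
    obtain ⟨t, ht⟩ := hΔ _ (w j).2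
    obtain ⟨c, rfl⟩ := TensorProduct.eq_repr_basis_left w t
    refine ⟨c, ?_⟩
    rw [← ht, Finsupp.sum_fintype _ _ (by simp), map_sum]
    simp
  choose c hc using hc
  have hf : ∀ i, ∃ f : B →ₗ[F] F, f ∘ₗ W.subtype = w.coord i := fun i =>
    LinearMap.exists_extend _
  choose f hf using hf
  have hfw : ∀ i j, f i (w j : B) = if j = i then 1 else 0 := fun i j => by
    have := LinearMap.congr_fun (hf i) (w j)
    simpa [Finsupp.single_apply] using this
  -- The indices are swapped because `c j i` is the coefficient of `w i` in the coaction on `w j`.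
  -- The functionals `f i` extract such coefficients from coassociativity and the counit law.
  refine ⟨_, fun i j => c j i, ⟨fun i j => ?_, fun i j => ?_⟩, ?_⟩
  · have h1 := Coalgebra.coassoc_apply (R := F) (w j : B)
    rw [hc] at h1
    simp only [map_sum, LinearMap.rTensor_tmul, LinearMap.lTensor_tmul, hc,
      TensorProduct.sum_tmul, TensorProduct.assoc_tmul] at h1
    have h2 := congrArg
      ((TensorProduct.lid F (B ⊗[F] B)).toLinearMap ∘ₗ (f i).rTensor (B ⊗[F] B)) h1
    simp [hfw] at h2
    rw [← h2]
  · have h1 := Coalgebra.lTensor_counit_comul (R := F) (w j : B)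
    rw [hc] at h1
    have h2 := congrArg (f i ∘ₗ (TensorProduct.rid F B).toLinearMap) h1
    simp [hfw] at h2
    rw [h2]
    simp [eq_comm]
  · have haW : a ∈ W := by
      have h1 := Coalgebra.lTensor_counit_comul (R := F) a
      rw [← hb] at h1
      have h2 := congrArg (TensorProduct.rid F B) h1
      simp only [Finsupp.sum, map_sum, LinearMap.lTensor_tmul, TensorProduct.rid_tmul,
        one_smul] at h2
      rw [← h2]
      exact Submodule.sum_mem _ fun i hi => Submodule.smul_mem _ _ (hbW i hi)
    have hw : ∀ j, (w j : B) ∈ Submodule.span F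
        (Set.range fun p : Fin (Module.finrank F W) × Fin (Module.finrank F W) => c p.2 p.1) := by
      intro j
      have h1 := Coalgebra.rTensor_counit_comul (R := F) (w j : B)
      rw [hc] at h1
      have h2 := congrArg (TensorProduct.lid F B) h1
      simp only [map_sum, LinearMap.rTensor_tmul, TensorProduct.lid_tmul, one_smul] at h2
      rw [← h2]
      exact Submodule.sum_mem _ fun i _ => Submodule.smul_mem _ _
        (Submodule.subset_span ⟨(i, j), rfl⟩)
    have h3 : a = ∑ j, w.repr ⟨a, haW⟩ j • (w j : B) := by
      have := congrArg Subtype.val (w.sum_repr ⟨a, haW⟩)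
      rw [Submodule.coe_sum] at this
      exact this.symm
    rw [h3]
    exact Submodule.sum_mem _ fun j _ => Submodule.smul_mem _ _ (hw j)

end MatrixRep

open Polynomial

/-! ### Points of unipotent subgroups -/

section UnipotentSubgroup

variable {F A : Type*} [Field F] [CommRing A] [HopfAlgebra F A]

lemma IsMatrixRep.map_mul {n : ℕ} {c : Matrix (Fin n) (Fin n) A} (hc : IsMatrixRep (F := F) c)
    (x y : Points F A) : c.map (x * y).ofConv = c.map x.ofConv * c.map y.ofConv := by
  ext i j
  rw [Matrix.map_apply, Matrix.mul_apply, mul_apply_eq_sum x y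
    ⟨Finset.univ, fun k => c i k, fun k => c k j, (hc.comul_apply i j).symm⟩]
  rfl

lemma IsMatrixRep.map_one {n : ℕ} {c : Matrix (Fin n) (Fin n) A} (hc : IsMatrixRep (F := F) c) :
    c.map (1 : Points F A).ofConv = 1 := by
  ext i j
  rw [Matrix.map_apply, one_apply, hc.counit_apply, Matrix.one_apply]

/-- The homomorphism `M(F) → GLₙ(F)` given by a matrix representation. -/
def IsMatrixRep.pointsHom {n : ℕ} {c : Matrix (Fin n) (Fin n) A} (hc : IsMatrixRep (F := F) c) :
    Points F A →* Matrix (Fin n) (Fin n) F where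
  toFun x := c.map x.ofConv
  map_one' := hc.map_one
  map_mul' := hc.map_mul

lemma IsMatrixRep.map_mk {n : ℕ} {c : Matrix (Fin n) (Fin n) A} (hc : IsMatrixRep (F := F) c)
    (I : Ideal A) [I.IsHopfIdeal F] :
    IsMatrixRep (F := F) (c.map (Ideal.Quotient.mk I)) where
  comul_apply i j := by
    have h : Coalgebra.comul (R := F) (Ideal.Quotient.mk I (c i j)) =
        TensorProduct.map (Ideal.Quotient.mkₐ F I).toLinearMap (Ideal.Quotient.mkₐ F I).toLinearMap
          (Coalgebra.comul (R := F) (c i j)) := rfl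
    simp [h, hc.comul_apply]
  counit_apply i j := hc.counit_apply i j

lemma prod_pointsHom_sub_one_eq_zero {I : Ideal A} [I.IsHopfIdeal F]
    (hI : IsUnipotentGroup F (A ⧸ I)) {n : ℕ} {c : Matrix (Fin n) (Fin n) A}
    (hc : IsMatrixRep (F := F) c) (l : List (subgroupPoints (F := F) I)) (hl : n ≤ l.length) :
    (l.map fun x : subgroupPoints (F := F) I => hc.pointsHom (x : Points F A) - 1).prod = 0 := by
  let q : subgroupPoints (F := F) I → (A ⧸ I →ₐ[F] F) := fun x =>
    Ideal.Quotient.liftₐ I (x : Points F A).ofConv x.2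
  have hq : ∀ x : subgroupPoints (F := F) I,
      hc.pointsHom x = (c.map (Ideal.Quotient.mk I)).map (q x) := fun x => rfl
  have h := hI.prod_sub_one_eq_zero n _ (hc.map_mk I) ((l.take n).map q) (by simpa using hl)
  rw [← List.prod_take_mul_prod_drop _ n, ← List.map_take]
  rw [List.map_map] at h
  have h' : ((l.take n).map fun x : subgroupPoints (F := F) I =>
      hc.pointsHom (x : Points F A) - 1).prod = 0 := h
  rw [h', zero_mul]

/-- The points of a unipotent subgroup are unipotent. -/
lemma isUnipotent_of_mem_subgroupPoints [CharZero F] {I : Ideal A} [I.IsHopfIdeal F]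
    (hI : IsUnipotentGroup F (A ⧸ I)) {x : Points F A} (hx : x ∈ subgroupPoints (F := F) I) :
    IsUnipotent x := by
  refine isUnipotent_of_polynomial fun a => ?_
  obtain ⟨n, c, hc, ha⟩ := exists_isMatrixRep_mem_span (F := F) a
  have h1 : (hc.pointsHom x - 1) ^ n = 0 := by
    have := prod_pointsHom_sub_one_eq_zero hI hc (List.replicate n ⟨x, hx⟩) (by simp)
    simpa using this
  induction ha using Submodule.span_induction with
  | mem a ha =>
    obtain ⟨⟨i, j⟩, rfl⟩ := ha
    -- The powers of the matrix of `x` form the orbit of the identity matrix under left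
    -- multiplication.
    let T : Module.End F (Matrix (Fin n) (Fin n) F) := LinearMap.mulLeft F (hc.pointsHom x)
    have hT : ((T - 1) ^ n) 1 = 0 := by
      have : T - 1 = LinearMap.mulLeft F (hc.pointsHom x - 1) := by ext; simp [T, sub_mul]
      rw [this, LinearMap.pow_mulLeft, h1]
      simp
    obtain ⟨p, -, hp⟩ := exists_polynomial_of_pow_sub_one_apply_eq_zero T 1 n hT
      (Matrix.entryLinearMap F F i j)
    refine ⟨p, fun k => ?_⟩
    rw [← hp, LinearMap.pow_mulLeft, ← map_pow]
    simp [IsMatrixRep.pointsHom]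
  | zero => exact ⟨0, by simp⟩
  | add a b _ _ ha hb =>
    obtain ⟨p, hp⟩ := ha
    obtain ⟨q, hq⟩ := hb
    exact ⟨p + q, fun n => by rw [_root_.map_add, hp, hq, eval_add]⟩
  | smul t a _ ha =>
    obtain ⟨p, hp⟩ := ha
    exact ⟨C t * p, fun n => by rw [_root_.map_smul, hp, eval_C_mul, smul_eq_mul]⟩

/-- The group of points of a unipotent subgroup of an algebraic group is nilpotent. -/
theorem isNilpotent_subgroupPoints [Algebra.FiniteType F A] {I : Ideal A} [I.IsHopfIdeal F]
    (hI : IsUnipotentGroup F (A ⧸ I)) : Group.IsNilpotent (subgroupPoints (F := F) I) := by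
  obtain ⟨S, hS⟩ := (Algebra.FiniteType.out : (⊤ : Subalgebra F A).FG)
  choose n c hc hac using fun a : A => exists_isMatrixRep_mem_span (F := F) a
  -- One representation for each of finitely many algebra generators gives a faithful product, and
  -- the largest dimension bounds the length of nonzero products.
  let ρ : subgroupPoints (F := F) I →* ∀ a : S, Matrix (Fin (n a)) (Fin (n a)) F :=
    MonoidHom.pi fun a => (hc a).pointsHom.comp (subgroupPoints (F := F) I).subtype
  refine Group.isNilpotent_of_prod_sub_one_eq_zero (F := F) ρ (fun x y hxy => ?_) (S.sup n)
    fun l hl => ?_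
  · have h1 : (x : Points F A).ofConv = (y : Points F A).ofConv := by
      refine AlgHom.ext_of_adjoin_eq_top hS fun a ha => ?_
      have h2 := congrFun hxy ⟨a, ha⟩
      have h3 : ∀ b ∈ Submodule.span F (Set.range fun p : Fin (n a) × Fin (n a) => c a p.1 p.2),
          (x : Points F A).ofConv b = (y : Points F A).ofConv b := fun b hb => by
        induction hb using Submodule.span_induction with
        | mem b hb =>
          obtain ⟨⟨i, j⟩, rfl⟩ := hb
          exact congrFun (congrFun h2 i) j
        | zero => simp
        | add b b' _ _ hb hb' => rw [_root_.map_add, _root_.map_add, hb, hb']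
        | smul t b _ hb => rw [_root_.map_smul, _root_.map_smul, hb]
      exact h3 a (hac a)
    exact Subtype.ext (WithConv.ofConv_injective h1)
  · funext a
    have h1 := prod_pointsHom_sub_one_eq_zero hI (hc a) l (hl ▸ Finset.le_sup a.2)
    have h2 := map_list_prod (Pi.evalMonoidHom _ a) (l.map fun x => ρ x - 1)
    rw [List.map_map] at h2
    exact h2.trans h1

end UnipotentSubgroup

/-! ### The Zariski closure of the powers of a unipotent point -/

section OneParameter

variable {F A : Type*} [Field F] [CommRing A] [HopfAlgebra F A]

/-- A tensor killed by all pairs of functionals from separating families vanishes. -/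
lemma tensor_eq_zero_of_forall {B : Type*} [AddCommGroup B] [Module F B] {ι : Type*}
    (x : ι → B →ₗ[F] F) (hx : ∀ b, (∀ i, x i b = 0) → b = 0) (t : B ⊗[F] B)
    (ht : ∀ i j, TensorProduct.lid F F (TensorProduct.map (x i) (x j) t) = 0) : t = 0 := by
  let 𝒞 := Module.Basis.ofVectorSpace F B
  obtain ⟨b, rfl⟩ := TensorProduct.eq_repr_basis_right 𝒞 t
  have h1 : ∀ i, (b.sum fun k m => x i m • 𝒞 k) = 0 := fun i => hx _ fun j => by
    have := ht i j
    simpa [Finsupp.sum, map_sum] using this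
  have h2 : ∀ k ∈ b.support, b k = 0 := fun k hk => hx _ fun i =>
    linearIndependent_iff'.mp 𝒞.linearIndependent b.support (fun k => x i (b k)) (h1 i) k hk
  rw [Finsupp.sum]
  exact Finset.sum_eq_zero fun k hk => by rw [h2 k hk, TensorProduct.zero_tmul]

variable [CharZero F]

/-- The ideal of functions vanishing on the one-parameter subgroup through `u`. -/
def IsUnipotent.orbitIdeal {u : Points F A} (hu : IsUnipotent u) : Ideal A :=
  RingHom.ker hu.orbitHom

lemma IsUnipotent.mem_orbitIdeal {u : Points F A} (hu : IsUnipotent u) {a : A} :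
    a ∈ hu.orbitIdeal ↔ ∀ n : ℕ, (u ^ n).ofConv a = 0 := by
  rw [orbitIdeal, RingHom.mem_ker]
  refine ⟨fun h n => ?_, fun h => eq_of_eval_natCast_eq fun n => ?_⟩
  · rw [← hu.eval_orbitHom, h, eval_zero]
  · rw [hu.eval_orbitHom, h, eval_zero]

/-- The points `u ^ n` separate the quotient, hence pairs of them separate its tensor square, and
stability under the coproduct follows from `u ^ i * u ^ j = u ^ (i + j)`. For the antipode, `u ^
(-n)` is also a value of the one-parameter subgroup. -/
lemma IsUnipotent.isHopfIdeal_orbitIdeal {u : Points F A} (hu : IsUnipotent u) :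
    hu.orbitIdeal.IsHopfIdeal F where
  counit_eq_zero a ha := by
    have := hu.mem_orbitIdeal.mp ha 0
    rwa [pow_zero, one_apply] at this
  map_mkQ_comul_eq_zero a ha := by
    let I := hu.orbitIdeal.restrictScalars F
    let x : ℕ → (A ⧸ I) →ₗ[F] F := fun n => I.liftQ (u ^ n).ofConv.toLinearMap
      fun a ha => hu.mem_orbitIdeal.mp ha n
    refine tensor_eq_zero_of_forall x (fun b hb => ?_) _ fun i j => ?_
    · obtain ⟨b, rfl⟩ := I.mkQ_surjective b
      exact (Submodule.Quotient.mk_eq_zero I).mpr (hu.mem_orbitIdeal.mpr hb)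
    · have h1 := hu.mem_orbitIdeal.mp ha (i + j)
      have r := Coalgebra.Repr.arbitrary F a
      rw [pow_add, mul_apply_eq_sum _ _ r] at h1
      rw [← r.eq]
      simp only [map_sum, TensorProduct.map_tmul, TensorProduct.lid_tmul, smul_eq_mul]
      exact h1
  antipode_mem a ha := by
    have h0 : hu.orbitHom a = 0 := ha
    refine hu.mem_orbitIdeal.mpr fun n => ?_
    rw [← inv_apply]
    have h1 : (u ^ n)⁻¹ = hu.fieldPow (-n) := by
      have h2 := hu.fieldPow_add (-n) n
      have h3 := hu.fieldPow_natCast 0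
      rw [neg_add_cancel, hu.fieldPow_natCast, ← Nat.cast_zero, h3, pow_zero] at h2
      exact inv_eq_of_mul_eq_one_left h2.symm
    rw [h1, hu.fieldPow_apply, h0, eval_zero]

/-- The matrix entries at `u ^ n` are polynomial in `n`, so `u` acts unipotently and fixes a nonzero
vector. The powers of `u` fix it too, and being Zariski dense they force the whole group scheme to
fix it. -/
lemma IsUnipotent.isUnipotentGroup_orbitIdeal {u : Points F A} (hu : IsUnipotent u)
    [hu.orbitIdeal.IsHopfIdeal F] : IsUnipotentGroup F (A ⧸ hu.orbitIdeal) := by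
  intro n c hn hc
  let q : ℕ → (A ⧸ hu.orbitIdeal →ₐ[F] F) := fun n =>
    Ideal.Quotient.liftₐ hu.orbitIdeal (u ^ n).ofConv fun a ha => hu.mem_orbitIdeal.mp ha n
  have hq : ∀ b, (∀ n, q n b = 0) → b = 0 := fun b hb => by
    obtain ⟨b, rfl⟩ := Ideal.Quotient.mk_surjective b
    exact Ideal.Quotient.eq_zero_iff_mem.mpr (hu.mem_orbitIdeal.mpr hb)
  -- the images of the matrix under the points `u ^ n` are the powers of the image under `u`
  have hpow : ∀ n, c.map (q n) = c.map (q 1) ^ n := by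
    have hmul : ∀ n m, c.map (q (n + m)) = c.map (q n) * c.map (q m) := fun n m => by
      ext i j
      have h1 : ∀ b, q (n + m) b = TensorProduct.lid F F (TensorProduct.map (q n).toLinearMap
          (q m).toLinearMap (Coalgebra.comul (R := F) b)) := fun b => by
        obtain ⟨b, rfl⟩ := Ideal.Quotient.mk_surjective b
        have h : Coalgebra.comul (R := F) (Ideal.Quotient.mk hu.orbitIdeal b) =
            TensorProduct.map (Ideal.Quotient.mkₐ F hu.orbitIdeal).toLinearMap
              (Ideal.Quotient.mkₐ F hu.orbitIdeal).toLinearMap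
              (Coalgebra.comul (R := F) b) := rfl
        have r := Coalgebra.Repr.arbitrary F b
        have h2 : q (n + m) (Ideal.Quotient.mk _ b) = (u ^ n * u ^ m).ofConv b := by
          rw [← pow_add]
          rfl
        rw [h, h2, mul_apply_eq_sum _ _ r, ← r.eq]
        simp only [map_sum, TensorProduct.map_tmul, TensorProduct.lid_tmul, smul_eq_mul]
        rfl
      rw [Matrix.map_apply, h1, hc.comul_apply, Matrix.mul_apply]
      simp [map_sum]
    intro n
    induction n with
    | zero =>
      ext i j
      have h1 : ∀ b, q 0 b = Coalgebra.counit (R := F) b := fun b => by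
        obtain ⟨b, rfl⟩ := Ideal.Quotient.mk_surjective b
        exact (congrArg (fun x : Points F A => x.ofConv b) (pow_zero u)).trans (one_apply b)
      rw [pow_zero, Matrix.map_apply, h1, hc.counit_apply, Matrix.one_apply]
    | succ n ih => rw [hmul, ih, pow_succ]
  have hpoly : ∀ b, ∃ p : F[X], ∀ n : ℕ, q n b = p.eval (n : F) := fun b => by
    obtain ⟨b, rfl⟩ := Ideal.Quotient.mk_surjective b
    exact hu.exists_polynomial b
  choose p hp using hpoly
  let T : Module.End F (Fin n → F) := (c.map (q 1)).mulVecLin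
  have hT : ∀ k, T ^ k = (c.map (q k)).mulVecLin := fun k => by
    rw [hpow, ← Matrix.toLin'_apply', Matrix.toLin'_pow]
    rfl
  -- a nonzero vector killed by a power of `T - 1` yields a fixed vector
  have hfix : ∃ v : Fin n → F, v ≠ 0 ∧ (T - 1) v = 0 := by
    let w : Fin n → F := Pi.single ⟨0, hn⟩ 1
    have hw : w ≠ 0 := by simp [w]
    have hK : ∃ K : ℕ, ((T - 1) ^ K) w = 0 := by
      refine exists_pow_sub_one_apply_eq_zero T w Finset.univ (fun i => p (c i ⟨0, hn⟩))
        (fun i => Pi.single i 1) fun k => ?_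
      rw [hT]
      ext i
      simp [w, ← hp, Pi.single_apply]
    classical
    have h0 : Nat.find hK ≠ 0 := fun h => hw (by simpa [h] using Nat.find_spec hK)
    obtain ⟨K, hK'⟩ := Nat.exists_eq_succ_of_ne_zero h0
    refine ⟨((T - 1) ^ K) w, Nat.find_min hK (by omega), ?_⟩
    have := Nat.find_spec hK
    rwa [hK', Nat.succ_eq_add_one, pow_succ', Module.End.mul_apply] at this
  obtain ⟨v, hv, hTv⟩ := hfix
  refine ⟨v, hv, fun i => ?_⟩
  have hTv' : T v = v := sub_eq_zero.mp hTv
  rw [← sub_eq_zero]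
  refine hq _ fun k => ?_
  have h1 : (T ^ k) v = v := by
    induction k with
    | zero => simp
    | succ k ih => rw [pow_succ, Module.End.mul_apply, hTv', ih]
  have h2 := congrFun h1 i
  rw [hT, Matrix.mulVecLin_apply, Matrix.mulVec, dotProduct] at h2
  rw [map_sub, map_sum, AlgHom.commutes, Algebra.algebraMap_self_apply, sub_eq_zero, ← h2]
  refine Finset.sum_congr rfl fun j _ => ?_
  rw [_root_.map_smul, smul_eq_mul, mul_comm]
  rfl

lemma IsUnipotent.mem_subgroupPoints_orbitIdeal {u : Points F A} (hu : IsUnipotent u)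
    [hu.orbitIdeal.IsHopfIdeal F] : u ∈ subgroupPoints (F := F) hu.orbitIdeal := fun a ha => by
  have := hu.mem_orbitIdeal.mp ha 1
  rwa [pow_one] at this

end OneParameter

end AffineGroup

/-! ### Jordan–Chevalley decomposition of locally finite operators -/

section JordanChevalley

open Polynomial

variable {F V : Type*} [Field F] [AddCommGroup V] [Module F V]

/-- Simple roots of a polynomial that differ by a nilpotent are equal. -/
lemma eq_of_aeval_eq_zero_of_isNilpotent_sub {C : Type*} [CommRing C] [Algebra F C] {s s' : C}
    {R : F[X]} (hR : R.Separable) (hs : aeval s R = 0) (hs' : aeval s' R = 0)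
    (h : IsNilpotent (s - s')) : s = s' := by
  have hu : IsUnit (aeval s (derivative R)) := by
    obtain ⟨a, b, hab⟩ := hR
    have := congrArg (aeval s) hab
    rw [map_add, map_mul, map_mul, hs, mul_zero, zero_add, map_one] at this
    exact .of_mul_eq_one_right _ this
  exact (existsUnique_nilpotent_sub_and_aeval_eq_zero (by rw [hs]; exact .zero) hu).unique
    ⟨by rw [sub_self]; exact .zero, hs⟩ ⟨h, hs'⟩

/-- Uniqueness of the semisimple part, at a single vector. -/
theorem Commute.apply_eq_of_squarefree [PerfectField F] {S S' : Module.End F V}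
    (hSS' : Commute S S') {v : V} {R R' : F[X]} (hR : Squarefree R) (hR' : Squarefree R')
    (hS : aeval S R v = 0) (hS' : aeval S' R' v = 0) (h : ∃ k : ℕ, ((S - S') ^ k) v = 0) :
    S v = S' v := by
  classical
  have hmem : ∀ X ∈ ({S, S'} : Set (Module.End F V)), ∀ Y ∈ ({S, S'} : Set (Module.End F V)),
      X * Y = Y * X := by
    rintro X (rfl | rfl) Y (rfl | rfl)
    exacts [rfl, hSS', hSS'.symm, rfl]
  let C := Algebra.adjoin F ({S, S'} : Set (Module.End F V))
  have hC : IsMulCommutative C := Algebra.isMulCommutative_adjoin F hmem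
  let _ : CommRing C := { (inferInstance : Ring C) with mul_comm := hC.is_comm.comm }
  -- Modulo the annihilator of `v` in the commutative algebra generated by `S` and `S'`, the claim
  -- says that two roots of polynomials coincide.
  let I : Ideal C :=
    { carrier := {c | c.1 v = 0}
      zero_mem' := rfl
      add_mem' := fun {a b} ha hb => by
        change a.1 v + b.1 v = 0
        rw [show a.1 v = 0 from ha, show b.1 v = 0 from hb, add_zero]
      smul_mem' := fun c a ha => by
        change c.1 (a.1 v) = 0
        rw [show a.1 v = 0 from ha, map_zero] }
  let s : C := ⟨S, Algebra.subset_adjoin (by simp)⟩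
  let s' : C := ⟨S', Algebra.subset_adjoin (by simp)⟩
  have hev : ∀ (c : C) (p : F[X]), (aeval c p).1 = aeval c.1 p := fun c p =>
    (aeval_algHom_apply C.val c p).symm
  have hmk : ∀ (c : C) (p : F[X]), aeval (Ideal.Quotient.mk I c) p =
      Ideal.Quotient.mk I (aeval c p) :=
    fun c p => aeval_algHom_apply (Ideal.Quotient.mkₐ F I) c p
  -- A single separable polynomial with both classes as roots.
  let Q := UniqueFactorizationMonoid.radical (R * R')
  have hQ : Q.Separable :=
    PerfectField.separable_iff_squarefree.mpr UniqueFactorizationMonoid.squarefree_radical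
  have hne : R * R' ≠ 0 := mul_ne_zero hR.ne_zero hR'.ne_zero
  have hRQ : R ∣ Q := (UniqueFactorizationMonoid.dvd_radical_iff hR.isRadical hne).mpr
    (dvd_mul_right _ _)
  have hRQ' : R' ∣ Q := (UniqueFactorizationMonoid.dvd_radical_iff hR'.isRadical hne).mpr
    (dvd_mul_left _ _)
  have h1 : aeval (Ideal.Quotient.mk I s) Q = 0 := by
    obtain ⟨q, hq⟩ := hRQ
    have : aeval (Ideal.Quotient.mk I s) R = 0 := by
      rw [hmk, Ideal.Quotient.eq_zero_iff_mem]
      change (aeval s R).1 v = 0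
      rw [hev]
      exact hS
    rw [hq, map_mul, this, zero_mul]
  have h2 : aeval (Ideal.Quotient.mk I s') Q = 0 := by
    obtain ⟨q, hq⟩ := hRQ'
    have : aeval (Ideal.Quotient.mk I s') R' = 0 := by
      rw [hmk, Ideal.Quotient.eq_zero_iff_mem]
      change (aeval s' R').1 v = 0
      rw [hev]
      exact hS'
    rw [hq, map_mul, this, zero_mul]
  have h3 : IsNilpotent (Ideal.Quotient.mk I s - Ideal.Quotient.mk I s') := by
    obtain ⟨k, hk⟩ := h
    refine ⟨k, ?_⟩
    rw [← map_sub, ← map_pow, Ideal.Quotient.eq_zero_iff_mem]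
    exact hk
  have h4 := eq_of_aeval_eq_zero_of_isNilpotent_sub hQ h1 h2 h3
  rw [Ideal.Quotient.eq] at h4
  exact sub_eq_zero.mp h4

/-- Modulo a nonzero polynomial `q`, the variable is congruent modulo nilpotents to a root `f` of a
squarefree polynomial. -/
lemma exists_comp_dvd_of_ne_zero [PerfectField F] {q : F[X]} (hq : q ≠ 0) :
    ∃ f R : F[X], Squarefree R ∧ q ∣ R.comp f ∧ ∃ k : ℕ, q ∣ (X - f) ^ k := by
  classical
  let R := UniqueFactorizationMonoid.radical q
  have hRs : Squarefree R := UniqueFactorizationMonoid.squarefree_radical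
  have hR : R.Separable := PerfectField.separable_iff_squarefree.mpr hRs
  obtain ⟨n, hn⟩ := UniqueFactorizationMonoid.exists_dvd_radical_self_pow hq
  let I := Ideal.span {q}
  let x : F[X] ⧸ I := Ideal.Quotient.mk I X
  have hmk : ∀ f p : F[X], aeval (Ideal.Quotient.mk I f) p = Ideal.Quotient.mk I (p.comp f) :=
    fun f p => by
      rw [← Ideal.Quotient.mkₐ_eq_mk F, aeval_algHom_apply, comp_eq_aeval]
  have hmem : ∀ f, Ideal.Quotient.mk I f = 0 ↔ q ∣ f := fun f => by
    rw [Ideal.Quotient.eq_zero_iff_mem, Ideal.mem_span_singleton]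
  have h1 : IsNilpotent (aeval x R) := ⟨n, by
    rw [hmk, comp_X, ← map_pow, hmem]
    exact hn⟩
  have h2 : IsUnit (aeval x (derivative R)) := by
    obtain ⟨a, b, hab⟩ := hR
    have h3 := congrArg (aeval x) hab
    rw [map_add, map_mul, map_mul, map_one] at h3
    have h4 : IsUnit (1 - aeval x a * aeval x R) :=
      ((Commute.all _ _).isNilpotent_mul_left h1).isUnit_one_sub
    rw [← h3, add_sub_cancel_left] at h4
    exact isUnit_of_mul_isUnit_right h4
  -- Newton's method: `x` is a simple root of `R` up to nilpotents, so it can be corrected by a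
  -- nilpotent to an exact root.
  obtain ⟨r, ⟨hr, hr'⟩, -⟩ := existsUnique_nilpotent_sub_and_aeval_eq_zero h1 h2
  obtain ⟨f, rfl⟩ := Ideal.Quotient.mk_surjective r
  obtain ⟨k, hk⟩ := hr
  refine ⟨f, R, hRs, ?_, k, ?_⟩
  · rwa [hmk, hmem] at hr'
  · rwa [← map_sub, ← map_pow, hmem] at hk

/-- Polynomials in intertwined operators are intertwined. -/
lemma map_aeval_apply {W : Type*} [AddCommGroup W] [Module F W] (φ : V →ₗ[F] W)
    {T : Module.End F V} {T' : Module.End F W} (h : ∀ v, φ (T v) = T' (φ v)) (p : F[X]) (v : V) :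
    φ (aeval T p v) = aeval T' p (φ v) := by
  have hpow : ∀ (n : ℕ) v, φ ((T ^ n) v) = (T' ^ n) (φ v) := fun n => by
    induction n with
    | zero => simp
    | succ n ih => intro v; rw [pow_succ, pow_succ, Module.End.mul_apply, ih, h]; rfl
  induction p using Polynomial.induction_on' with
  | add p q hp hq => simp [hp, hq]
  | monomial n a => simp [aeval_monomial, hpow]

lemma apply_mem_ker_aeval (S : Module.End F V) (q : F[X]) :
    ∀ v ∈ LinearMap.ker (aeval S q), S v ∈ LinearMap.ker (aeval S q) := fun v hv => by
  have h := (Commute.all q X).map (aeval S)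
  rw [aeval_X] at h
  rw [LinearMap.mem_ker, ← Module.End.mul_apply, h.eq, Module.End.mul_apply,
    LinearMap.mem_ker.mp hv, map_zero]

lemma aeval_apply_eq_zero_of_dvd {T : Module.End F V} {p q : F[X]} (h : q ∣ p) {v : V}
    (hv : aeval T q v = 0) : aeval T p v = 0 := by
  obtain ⟨r, rfl⟩ := h
  rw [mul_comm, map_mul, Module.End.mul_apply, hv, map_zero]

/-- A polynomial `f` such that `f(T)` is the semisimple part of `T` on vectors killed by `q(T)`. -/
def semisimplePartPoly [PerfectField F] (q : F[X]) : F[X] :=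
  open Classical in if h : q ≠ 0 then (exists_comp_dvd_of_ne_zero h).choose else 0

lemma exists_squarefree_semisimplePartPoly [PerfectField F] {q : F[X]} (hq : q ≠ 0)
    {T : Module.End F V} {v : V} (hv : aeval T q v = 0) :
    ∃ R : F[X], Squarefree R ∧ aeval (aeval T (semisimplePartPoly q)) R v = 0 := by
  obtain ⟨R, hR, h, -⟩ := (exists_comp_dvd_of_ne_zero hq).choose_spec
  refine ⟨R, hR, ?_⟩
  rw [← aeval_comp, semisimplePartPoly, dif_pos hq]
  exact aeval_apply_eq_zero_of_dvd h hv

lemma exists_sub_semisimplePartPoly_pow [PerfectField F] {q : F[X]} (hq : q ≠ 0)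
    {T : Module.End F V} {v : V} (hv : aeval T q v = 0) :
    ∃ k : ℕ, ((T - aeval T (semisimplePartPoly q)) ^ k) v = 0 := by
  obtain ⟨R, hR, -, k, h⟩ := (exists_comp_dvd_of_ne_zero hq).choose_spec
  refine ⟨k, ?_⟩
  have := aeval_apply_eq_zero_of_dvd h hv
  rw [semisimplePartPoly, dif_pos hq]
  simpa using this

lemma exists_add_pow_apply_eq_zero {X Y : Module.End F V} (h : Commute X Y) {v : V}
    (hX : ∃ k : ℕ, (X ^ k) v = 0) (hY : ∃ k : ℕ, (Y ^ k) v = 0) :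
    ∃ k : ℕ, ((X + Y) ^ k) v = 0 := by
  obtain ⟨k, hk⟩ := hX
  obtain ⟨l, hl⟩ := hY
  refine ⟨k + l, ?_⟩
  rw [h.add_pow, LinearMap.sum_apply]
  refine Finset.sum_eq_zero fun i hi => ?_
  rw [← Nat.cast_comm, Module.End.mul_apply]
  refine (congrArg _ ?_).trans (map_zero _)
  rcases le_total k i with hki | hki
  · obtain ⟨j, rfl⟩ := Nat.exists_eq_add_of_le' hki
    rw [(h.pow_pow _ _).eq, pow_add, Module.End.mul_apply, Module.End.mul_apply, hk, map_zero,
      map_zero]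
  · obtain ⟨j, hj⟩ := Nat.exists_eq_add_of_le' (show l ≤ k + l - i by omega)
    rw [hj, pow_add, Module.End.mul_apply, Module.End.mul_apply, hl, map_zero, map_zero]

lemma exists_sub_pow_apply_eq_zero {X Y : Module.End F V} (h : Commute X Y) {v : V}
    (hX : ∃ k : ℕ, (X ^ k) v = 0) (hY : ∃ k : ℕ, (Y ^ k) v = 0) :
    ∃ k : ℕ, ((X - Y) ^ k) v = 0 := by
  obtain ⟨l, hl⟩ := hY
  rw [sub_eq_add_neg]
  exact exists_add_pow_apply_eq_zero h.neg_right hX ⟨l, by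
    rw [neg_pow, Module.End.mul_apply, hl, map_zero]⟩

/-- A semisimple operator commuting with `T` and differing from it by a nilpotent operator on `v`
agrees with the polynomial expression for the semisimple part. -/
lemma semisimplePartPoly_apply_eq [PerfectField F] {T S : Module.End F V} (hTS : Commute T S)
    {q : F[X]} (hq : q ≠ 0) {v : V} (hv : aeval T q v = 0) {R : F[X]} (hR : Squarefree R)
    (hS : aeval S R v = 0) (h : ∃ k : ℕ, ((T - S) ^ k) v = 0) :
    aeval T (semisimplePartPoly q) v = S v := by
  obtain ⟨R', hR', hf⟩ := exists_squarefree_semisimplePartPoly hq hv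
  have hTf : ∀ p : F[X], Commute T (aeval T p) := fun p => by
    have := Commute.all X p
    simpa using this.map (aeval T)
  have hSf : ∀ p : F[X], Commute S (aeval T p) := fun p => by
    induction p using Polynomial.induction_on' with
    | add p q hp hq => rw [map_add]; exact hp.add_right hq
    | monomial n a =>
      rw [aeval_monomial]
      exact (Algebra.commute_algebraMap_right a S).mul_right (hTS.symm.pow_right n)
  refine (hSf _).symm.apply_eq_of_squarefree hR' hR hf hS ?_
  have h1 : aeval T (semisimplePartPoly q) - S =
      (T - S) - (T - aeval T (semisimplePartPoly q)) := by abel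
  rw [h1]
  refine exists_sub_pow_apply_eq_zero ?_ h (exists_sub_semisimplePartPoly_pow hq hv)
  exact ((Commute.refl T).sub_left hTS.symm).sub_right ((hTf _).sub_left (hSf _))

/-- `S` is the semisimple part of the locally finite operator `T`. -/
def IsSemisimplePart [PerfectField F] (T S : Module.End F V) : Prop :=
  ∀ q : F[X], q ≠ 0 → ∀ v, aeval T q v = 0 → S v = aeval T (semisimplePartPoly q) v

/-- **Jordan–Chevalley decomposition** of a locally finite operator. -/
theorem exists_semisimplePart [PerfectField F] (T : Module.End F V)
    (hT : ∀ v, ∃ q : F[X], q ≠ 0 ∧ aeval T q v = 0) :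
    ∃ S : Module.End F V, IsSemisimplePart T S := by
  choose q hq hqv using hT
  have key : ∀ (q q' : F[X]) (v : V), q ≠ 0 → q' ≠ 0 → aeval T q v = 0 → aeval T q' v = 0 →
      aeval T (semisimplePartPoly q) v = aeval T (semisimplePartPoly q') v := by
    intro q q' v hq hq' hv hv'
    obtain ⟨R, hR, hf⟩ := exists_squarefree_semisimplePartPoly hq' hv'
    have hTf : Commute T (aeval T (semisimplePartPoly q')) := by
      simpa using (Commute.all X (semisimplePartPoly q')).map (aeval T)
    exact semisimplePartPoly_apply_eq hTf hq hv hR hf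
      (exists_sub_semisimplePartPoly_pow hq' hv')
  refine ⟨{ toFun := fun v => aeval T (semisimplePartPoly (q v)) v, map_add' := ?_,
            map_smul' := ?_ }, fun p hp v hv => key _ _ _ (hq v) hp (hqv v) hv⟩
  · intro v w
    -- The product kills `v`, `w` and `v + w`, so one polynomial in `T` computes all three values.
    have hne : q v * q w ≠ 0 := mul_ne_zero (hq v) (hq w)
    have h1 : aeval T (q v * q w) v = 0 := aeval_apply_eq_zero_of_dvd (dvd_mul_right _ _) (hqv v)
    have h2 : aeval T (q v * q w) w = 0 := aeval_apply_eq_zero_of_dvd (dvd_mul_left _ _) (hqv w)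
    rw [key _ _ v (hq v) hne (hqv v) h1, key _ _ w (hq w) hne (hqv w) h2,
      key _ _ (v + w) (hq _) hne (hqv _) (by rw [map_add, h1, h2, add_zero]), map_add]
  · intro c v
    have h1 : aeval T (q v) (c • v) = 0 := by rw [map_smul, hqv, smul_zero]
    rw [key _ _ (c • v) (hq _) (hq v) (hqv _) h1, map_smul]
    rfl

lemma aeval_apply_eq_of_eqOn {S S' : Module.End F V} {K : Submodule F V}
    (hK : ∀ w ∈ K, S w ∈ K) (h : ∀ w ∈ K, S' w = S w) (p : F[X]) {v : V} (hv : v ∈ K) :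
    aeval S' p v = aeval S p v := by
  have h1 := map_aeval_apply (T := S.restrict hK) (T' := S) K.subtype (fun _ => rfl) p ⟨v, hv⟩
  have h2 := map_aeval_apply (T := S.restrict hK) (T' := S') K.subtype
    (fun w => (h w w.2).symm) p ⟨v, hv⟩
  exact h2.symm.trans h1

lemma aeval_apply_mem_ker_aeval (T : Module.End F V) (p q : F[X]) :
    ∀ v ∈ LinearMap.ker (aeval T q), aeval T p v ∈ LinearMap.ker (aeval T q) := fun v hv => by
  rw [LinearMap.mem_ker, ← Module.End.mul_apply, ← map_mul, mul_comm, map_mul,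
    Module.End.mul_apply, LinearMap.mem_ker.mp hv, map_zero]

lemma IsSemisimplePart.exists_squarefree [PerfectField F] {T S : Module.End F V}
    (h : IsSemisimplePart T S) {q : F[X]} (hq : q ≠ 0) {v : V} (hv : aeval T q v = 0) :
    ∃ R : F[X], Squarefree R ∧ aeval S R v = 0 := by
  obtain ⟨R, hR, hRv⟩ := exists_squarefree_semisimplePartPoly hq hv
  refine ⟨R, hR, ?_⟩
  rwa [aeval_apply_eq_of_eqOn (aeval_apply_mem_ker_aeval T (semisimplePartPoly q) q)
    (fun w hw => h q hq w hw) R hv]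

lemma IsSemisimplePart.exists_sub_pow [PerfectField F] {T S : Module.End F V}
    (h : IsSemisimplePart T S) {q : F[X]} (hq : q ≠ 0) {v : V} (hv : aeval T q v = 0) :
    ∃ k : ℕ, ((T - S) ^ k) v = 0 := by
  obtain ⟨k, hk⟩ := exists_sub_semisimplePartPoly_pow hq hv
  have h1 := aeval_apply_eq_of_eqOn (S := T - aeval T (semisimplePartPoly q)) (S' := T - S)
    (fun w hw => sub_mem (apply_mem_ker_aeval T q w hw)
      (aeval_apply_mem_ker_aeval T (semisimplePartPoly q) q w hw))
    (fun w hw => by rw [LinearMap.sub_apply, LinearMap.sub_apply, h q hq w hw]) (X ^ k) hv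
  rw [map_pow, map_pow, aeval_X, aeval_X, hk] at h1
  exact ⟨k, h1⟩

lemma IsSemisimplePart.commute [PerfectField F] {T S U : Module.End F V}
    (h : IsSemisimplePart T S) (hT : ∀ v, ∃ q : F[X], q ≠ 0 ∧ aeval T q v = 0)
    (hU : Commute T U) : Commute S U := by
  have hp : ∀ (p : F[X]) v, U (aeval T p v) = aeval T p (U v) :=
    map_aeval_apply U fun v => LinearMap.congr_fun hU.eq.symm v
  refine LinearMap.ext fun v => ?_
  obtain ⟨q, hq, hqv⟩ := hT v
  rw [Module.End.mul_apply, Module.End.mul_apply, h q hq v hqv, hp,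
    h q hq (U v) (by rw [← hp, hqv, map_zero])]

/-- A locally finite semisimple operator is killed by a squarefree polynomial at every vector. -/
lemma Module.End.IsSemisimple.exists_squarefree [PerfectField F] {S : Module.End F V}
    (hS : S.IsSemisimple) {q : F[X]} (hq : q ≠ 0) {v : V} (hv : aeval S q v = 0) :
    ∃ R : F[X], Squarefree R ∧ aeval S R v = 0 := by
  classical
  -- `S` stays semisimple on this kernel, so its annihilator there is a radical ideal; it contains
  -- `q`, hence the radical of `q`.
  let K := LinearMap.ker (aeval S q)
  let S' : Module.End F K := S.restrict (apply_mem_ker_aeval S q)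
  have h : S'.IsSemisimple := hS.restrict (p := K) (apply_mem_ker_aeval S q)
  have hrad : (Module.annihilator F[X] (Module.AEval' S')).IsRadical :=
    have : IsSemisimpleModule F[X] (Module.AEval' S') := h
    IsSemisimpleModule.annihilator_isRadical _ _
  rw [Module.AEval.annihilator_eq_ker_aeval] at hrad
  have hι : ∀ (p : F[X]) w, ((aeval S' p w : K) : V) = aeval S p w := fun p w =>
    map_aeval_apply K.subtype (fun _ => rfl) p w
  obtain ⟨n, hn⟩ := UniqueFactorizationMonoid.exists_dvd_radical_self_pow hq
  have h1 : UniqueFactorizationMonoid.radical q ∈ RingHom.ker (aeval S') := by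
    refine hrad ⟨n, ?_⟩
    rw [RingHom.mem_ker]
    ext w
    rw [hι]
    exact aeval_apply_eq_zero_of_dvd hn w.2
  refine ⟨UniqueFactorizationMonoid.radical q, UniqueFactorizationMonoid.squarefree_radical, ?_⟩
  have := congrArg Subtype.val (LinearMap.congr_fun (RingHom.mem_ker.mp h1) ⟨v, hv⟩)
  rwa [hι] at this

/-- An operator killed by a squarefree polynomial at every vector is semisimple. -/
lemma Module.End.isSemisimple_of_forall_squarefree {S : Module.End F V}
    (h : ∀ v, ∃ R : F[X], Squarefree R ∧ aeval S R v = 0) : S.IsSemisimple := by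
  -- The space is the sum of the kernels of `R(S)` over squarefree `R`, each a semisimple submodule.
  refine isSemisimpleModule_of_isSemisimpleModule_submodule (ι := F[X]) (s := {R | Squarefree R})
    (p := fun R => Module.AEval.mapSubmodule F V S ⟨_, apply_mem_ker_aeval S R⟩)
    (fun R hR => ?_) ?_
  · let S' : Module.End F (LinearMap.ker (aeval S R)) := S.restrict (apply_mem_ker_aeval S R)
    have h1 : S'.IsSemisimple := by
      refine Module.End.isSemisimple_of_squarefree_aeval_eq_zero hR ?_
      ext w
      exact (map_aeval_apply (Submodule.subtype _) (fun _ => rfl) R w).trans w.2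
    exact (Module.AEval.restrict_equiv_mapSubmodule S _
      (apply_mem_ker_aeval S R)).isSemisimpleModule_iff.mp h1
  · refine top_le_iff.mp fun v _ => ?_
    obtain ⟨R, hR, hv⟩ := h ((Module.AEval.of F V S).symm v)
    exact (le_biSup (fun R => Module.AEval.mapSubmodule F V S ⟨_, apply_mem_ker_aeval S R⟩)
      (show R ∈ {R | Squarefree R} from hR)) ((Module.AEval.mem_mapSubmodule_apply ..).mpr hv)

end JordanChevalley

/-! ### Tensor products of semisimple and of locally finite operators -/

section TensorSemisimple

open Polynomial

variable {F V W : Type*} [Field F] [AddCommGroup V] [Module F V] [AddCommGroup W] [Module F W]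

/-- A vector killed by a nonzero polynomial in `S` lies in a finite-dimensional invariant subspace
killed by that polynomial. -/
lemma exists_finite_invariant {S : Module.End F V} {q : F[X]} (hq : q ≠ 0) {v : V}
    (hv : aeval S q v = 0) : ∃ K : Submodule F V, Module.Finite F K ∧ v ∈ K ∧
      (∀ w ∈ K, S w ∈ K) ∧ ∀ w ∈ K, aeval S q w = 0 := by
  let ψ : F[X] →ₗ[F] V := LinearMap.applyₗ v ∘ₗ (aeval S).toLinearMap
  have hψ : ∀ p, ψ p = aeval S p v := fun p => rfl
  have hcomm : ∀ p p' : F[X], aeval S p (aeval S p' v) = aeval S (p * p') v := fun p p' => by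
    rw [map_mul, Module.End.mul_apply]
  refine ⟨LinearMap.range ψ, ?_, ⟨1, by rw [hψ, map_one]; rfl⟩, ?_, ?_⟩
  · let I := (Ideal.span {q}).restrictScalars F
    have hI : I ≤ LinearMap.ker ψ := fun p hp => by
      have : p ∈ Ideal.span {q} := hp
      exact aeval_apply_eq_zero_of_dvd (Ideal.mem_span_singleton.mp this) hv
    have : Module.Finite F (F[X] ⧸ I) := (AdjoinRoot.powerBasis hq).finite
    rw [← Submodule.range_liftQ I ψ hI]
    infer_instance
  · rintro _ ⟨p, rfl⟩
    refine ⟨X * p, ?_⟩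
    rw [hψ, hψ, ← hcomm, aeval_X]
  · rintro _ ⟨p, rfl⟩
    rw [hψ, hcomm, mul_comm, ← hcomm, hv, map_zero]

/-- The tensor product of two semisimple operators is semisimple, at a pure tensor. -/
lemma exists_squarefree_tensor [PerfectField F] {S : Module.End F V} {S' : Module.End F W}
    {R R' : F[X]} (hR : Squarefree R) (hR' : Squarefree R') {v : V} {w : W}
    (hv : aeval S R v = 0) (hw : aeval S' R' w = 0) :
    ∃ Q : F[X], Squarefree Q ∧ aeval (TensorProduct.map S S') Q (v ⊗ₜ[F] w) = 0 := by
  obtain ⟨K, hK, hvK, hSK, hRK⟩ := exists_finite_invariant hR.ne_zero hv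
  obtain ⟨L, hL, hwL, hSL, hRL⟩ := exists_finite_invariant hR'.ne_zero hw
  let f : Module.End F K := S.restrict hSK
  let g : Module.End F L := S'.restrict hSL
  have hf : aeval f R = 0 := by
    ext x
    exact (map_aeval_apply K.subtype (fun _ => rfl) R x).trans (hRK _ x.2)
  have hg : aeval g R' = 0 := by
    ext x
    exact (map_aeval_apply L.subtype (fun _ => rfl) R' x).trans (hRL _ x.2)
  have h1 : Module.End.IsSemisimple (f.rTensor L) := by
    refine Module.End.isSemisimple_of_squarefree_aeval_eq_zero hR ?_
    ext x y
    have := map_aeval_apply (T := f) (T' := f.rTensor L) ((TensorProduct.mk F K L).flip y)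
      (fun _ => rfl) R x
    rw [hf] at this
    simpa using this.symm
  have h2 : Module.End.IsSemisimple (g.lTensor K) := by
    refine Module.End.isSemisimple_of_squarefree_aeval_eq_zero hR' ?_
    ext x y
    have := map_aeval_apply (T := g) (T' := g.lTensor K) (TensorProduct.mk F K L x)
      (fun _ => rfl) R' y
    rw [hg] at this
    simpa using this.symm
  have h3 : Commute (f.rTensor L) (g.lTensor K) := by
    rw [commute_iff_eq, Module.End.mul_eq_comp, Module.End.mul_eq_comp,
      LinearMap.rTensor_comp_lTensor, LinearMap.lTensor_comp_rTensor]
  let fg : Module.End F (K ⊗[F] L) := TensorProduct.map f g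
  -- `f ⊗ g` is the product of the commuting semisimple operators `f ⊗ 1` and `1 ⊗ g`, and over a
  -- perfect field such products are semisimple.
  have h4 : fg.IsSemisimple := by
    change Module.End.IsSemisimple (TensorProduct.map f g)
    rw [← LinearMap.rTensor_comp_lTensor]
    exact h1.mul_of_commute h3 h2
  refine ⟨minpoly F fg, h4.minpoly_squarefree, ?_⟩
  have := map_aeval_apply (T := fg) (T' := TensorProduct.map S S')
    (TensorProduct.map K.subtype L.subtype) (fun t => by
      induction t using TensorProduct.induction_on with
      | zero => simp
      | tmul x y => simp [f, g, fg]
      | add x y hx hy => simp only [map_add, hx, hy])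
    (minpoly F fg) (⟨v, hvK⟩ ⊗ₜ ⟨w, hwL⟩)
  have h0 := LinearMap.congr_fun (minpoly.aeval F fg) (⟨v, hvK⟩ ⊗ₜ ⟨w, hwL⟩)
  exact this.symm.trans ((congrArg _ h0).trans (map_zero _))

/-- The tensor product of two locally finite operators is locally finite, at a pure tensor. -/
lemma exists_aeval_tensor_eq_zero {T : Module.End F V} {T' : Module.End F W} {q q' : F[X]}
    (hq : q ≠ 0) (hq' : q' ≠ 0) {v : V} {w : W} (hv : aeval T q v = 0) (hw : aeval T' q' w = 0) :
    ∃ Q : F[X], Q ≠ 0 ∧ aeval (TensorProduct.map T T') Q (v ⊗ₜ[F] w) = 0 := by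
  obtain ⟨K, hK, hvK, hSK, -⟩ := exists_finite_invariant hq hv
  obtain ⟨L, hL, hwL, hSL, -⟩ := exists_finite_invariant hq' hw
  let f : Module.End F K := T.restrict hSK
  let g : Module.End F L := T'.restrict hSL
  let fg : Module.End F (K ⊗[F] L) := TensorProduct.map f g
  refine ⟨minpoly F fg, minpoly.ne_zero_of_finite F _, ?_⟩
  have := map_aeval_apply (T := fg) (T' := TensorProduct.map T T')
    (TensorProduct.map K.subtype L.subtype) (fun t => by
      induction t using TensorProduct.induction_on with
      | zero => simp
      | tmul x y => simp [f, g, fg]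
      | add x y hx hy => simp only [map_add, hx, hy])
    (minpoly F fg) (⟨v, hvK⟩ ⊗ₜ ⟨w, hwL⟩)
  have h0 := LinearMap.congr_fun (minpoly.aeval F fg) (⟨v, hvK⟩ ⊗ₜ ⟨w, hwL⟩)
  exact this.symm.trans ((congrArg _ h0).trans (map_zero _))

end TensorSemisimple

namespace AffineGroup

open Polynomial

/-! ### The Jordan decomposition in `M(F)` -/

section JordanPoints

variable {F A : Type*} [Field F] [CommRing A] [HopfAlgebra F A]

/-- Translations are locally finite. -/
lemma exists_aeval_translation_eq_zero (x : Points F A) (a : A) :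
    ∃ q : F[X], q ≠ 0 ∧ aeval (translation x) q a = 0 := by
  obtain ⟨W, hW, hWa⟩ := exists_finite_translation_mem (F := F) a
  have hmem : ∀ p : F[X], aeval (translation x) p a ∈ W := fun p => by
    induction p using Polynomial.induction_on' with
    | add p q hp hq => rw [map_add]; exact add_mem hp hq
    | monomial n c =>
      rw [aeval_monomial, ← translation_pow]
      exact Submodule.smul_mem _ c (hWa _)
  let ψ : F[X] →ₗ[F] W :=
    (LinearMap.applyₗ a ∘ₗ (aeval (translation x)).toLinearMap).codRestrict W hmem
  by_contra! h
  have hψ : Function.Injective ψ := (injective_iff_map_eq_zero ψ).mpr fun p hp => by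
    by_contra hp0
    exact h p hp0 (congrArg Subtype.val hp)
  exact Polynomial.not_finite (R := F) (Module.Finite.of_injective ψ hψ)

lemma IsEquivariant.aeval {T : Module.End F A} (hT : IsEquivariant T) (p : F[X]) :
    IsEquivariant (Polynomial.aeval T p) := by
  refine LinearMap.ext fun a => ?_
  have h1 := map_aeval_apply (T' := T.lTensor A) (Coalgebra.comul (R := F))
    (fun a => LinearMap.congr_fun hT a) p a
  have r := Coalgebra.Repr.arbitrary F a
  rw [LinearMap.comp_apply, LinearMap.comp_apply, h1, ← r.eq, map_sum, map_sum]
  exact Finset.sum_congr rfl fun i _ => (map_aeval_apply (T := T)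
    (TensorProduct.mk F A A (r.left i)) (fun _ => rfl) p (r.right i)).symm

lemma IsSemisimple.conj {x : Points F A} (hx : IsSemisimple x) (y : Points F A) :
    IsSemisimple (y * x * y⁻¹) := by
  let e : A ≃ₗ[F] A := .ofLinearMap (translation y) (translation y⁻¹) (translation_mul_inv y)
    (translation_inv_mul y)
  refine (LinearEquiv.isSemisimple_iff (f := translation x) (translation (y * x * y⁻¹)) e ?_).mp hx
  change translation y * translation x = translation (y * x * y⁻¹) * translation y
  rw [← translation_mul, ← translation_mul, inv_mul_cancel_right]

variable [PerfectField F]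

/-- The semisimple part of a translation is a translation. -/
lemma exists_isSemisimplePart_translation (x : Points F A) :
    ∃ s : Points F A, IsSemisimplePart (translation x) (translation s) := by
  set T := translation x
  have hT : ∀ a, ∃ q : F[X], q ≠ 0 ∧ Polynomial.aeval T q a = 0 :=
    exists_aeval_translation_eq_zero x
  obtain ⟨S, hS⟩ := exists_semisimplePart T hT
  have hTS : Commute T S := (hS.commute hT (Commute.refl T)).symm
  have hSs : ∀ a, ∃ R : F[X], Squarefree R ∧ aeval S R a = 0 := fun a => by
    obtain ⟨q, hq, hqa⟩ := hT a
    exact hS.exists_squarefree hq hqa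
  have hTSn : ∀ a, ∃ k : ℕ, ((T - S) ^ k) a = 0 := fun a => by
    obtain ⟨q, hq, hqa⟩ := hT a
    exact hS.exists_sub_pow hq hqa
  -- multiplicativity
  have hmul : ∀ a b, S (a * b) = S a * S b := fun a b => by
    obtain ⟨q, hq, hqa⟩ := hT a
    obtain ⟨q', hq', hqb⟩ := hT b
    -- At `a ⊗ b`, the semisimple part of `T ⊗ T` is `S ⊗ S`. Multiplication intertwines `T ⊗ T`
    -- with `T`, hence also their semisimple parts.
    obtain ⟨Q, hQ, hQab⟩ := exists_aeval_tensor_eq_zero hq hq' hqa hqb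
    obtain ⟨R, hR, hRa⟩ := hSs a
    obtain ⟨R', hR', hRb⟩ := hSs b
    obtain ⟨P, hP, hPab⟩ := exists_squarefree_tensor hR hR' hRa hRb
    have hc : Commute (TensorProduct.map T T) (TensorProduct.map S S) := by
      rw [commute_iff_eq, ← TensorProduct.map_mul, ← TensorProduct.map_mul, hTS.eq]
    have hn : ∃ k : ℕ, ((TensorProduct.map T T - TensorProduct.map S S) ^ k) (a ⊗ₜ[F] b) = 0 := by
      have h1 : TensorProduct.map T T - TensorProduct.map S S =
          TensorProduct.map (T - S) T + TensorProduct.map S (T - S) := by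
        ext; simp [TensorProduct.sub_tmul, TensorProduct.tmul_sub]
      rw [h1]
      refine exists_add_pow_apply_eq_zero ?_ ?_ ?_
      · have h2 : Commute (T - S) S := hTS.sub_left (Commute.refl S)
        have h3 : Commute T (T - S) := (Commute.refl T).sub_right hTS
        rw [commute_iff_eq, ← TensorProduct.map_mul, ← TensorProduct.map_mul, h2.eq, h3.eq]
      · obtain ⟨k, hk⟩ := hTSn a
        exact ⟨k, by rw [TensorProduct.map_pow, TensorProduct.map_tmul, hk,
            TensorProduct.zero_tmul]⟩
      · obtain ⟨k, hk⟩ := hTSn b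
        exact ⟨k, by rw [TensorProduct.map_pow, TensorProduct.map_tmul, hk,
            TensorProduct.tmul_zero]⟩
    have h1 := semisimplePartPoly_apply_eq hc hQ hQab hP hPab hn
    have hint : ∀ p : F[X], LinearMap.mul' F A (aeval (TensorProduct.map T T) p (a ⊗ₜ b)) =
        aeval T p (a * b) := fun p => by
      rw [map_aeval_apply (T' := T), LinearMap.mul'_apply]
      intro t
      induction t using TensorProduct.induction_on with
      | zero => simp
      | tmul x y => simp [T, translation_apply_mul]
      | add x y hx hy => simp only [map_add, hx, hy]
    rw [hS Q hQ (a * b) (by rw [← hint, hQab, map_zero]), ← hint, h1, TensorProduct.map_tmul,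
      LinearMap.mul'_apply]
  -- `T` fixes `1`, so `S 1` is a scalar `c`, and `1 - c` is nilpotent in a field.
  have hone : S 1 = 1 := by
    have h1 : ∀ p : F[X], aeval T p (1 : A) = p.eval 1 • (1 : A) := fun p => by
      induction p using Polynomial.induction_on' with
      | add p q hp hq => rw [map_add, LinearMap.add_apply, hp, hq, eval_add, add_smul]
      | monomial n c =>
        rw [aeval_monomial, ← translation_pow, Module.End.mul_apply, translation_apply_one]
        simp [Algebra.algebraMap_eq_smul_one]
    have h2 : S 1 = (semisimplePartPoly (X - C (1 : F))).eval 1 • (1 : A) := by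
      rw [hS (X - C 1) (X_sub_C_ne_zero 1) 1 (by rw [h1]; simp), h1]
    set c := (semisimplePartPoly (X - C (1 : F))).eval 1
    obtain ⟨k, hk⟩ := hTSn 1
    have h3 : ∀ k : ℕ, ((T - S) ^ k) (1 : A) = (1 - c) ^ k • (1 : A) := fun k => by
      induction k with
      | zero => simp
      | succ k ih =>
        rw [pow_succ, Module.End.mul_apply, LinearMap.sub_apply, h2, translation_apply_one]
        have : (1 : A) - c • (1 : A) = (1 - c) • (1 : A) := by rw [sub_smul, one_smul]
        rw [this, map_smul, ih, smul_smul, pow_succ']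
    rw [h3] at hk
    have h4 := congrArg (Coalgebra.counit (R := F)) hk
    rw [map_smul, Bialgebra.counit_one, map_zero, smul_eq_mul, mul_one] at h4
    rw [h2, ← sub_eq_zero.mp (IsReduced.eq_zero _ ⟨k, h4⟩), one_smul]
  have hequiv : IsEquivariant S := by
    refine LinearMap.ext fun a => ?_
    choose q hq hqa using hT
    have r := Coalgebra.Repr.arbitrary F a
    -- One polynomial killing `a` and all right components of its coproduct, so that on all of them
    -- `S` is the same polynomial in `T`, which is equivariant.
    let Q := q a * ∏ i ∈ r.index, q (r.right i)
    have hQ : Q ≠ 0 := mul_ne_zero (hq a) (Finset.prod_ne_zero_iff.mpr fun i _ => hq _)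
    have h1 : ∀ i ∈ r.index, S (r.right i) =
        aeval T (semisimplePartPoly Q) (r.right i) := fun i hi =>
      hS Q hQ _ (aeval_apply_eq_zero_of_dvd
        ((Finset.dvd_prod_of_mem _ hi).trans (dvd_mul_left _ _)) (hqa _))
    have h2 := LinearMap.congr_fun
      ((isEquivariant_translation x).aeval (semisimplePartPoly Q)) a
    rw [LinearMap.comp_apply, LinearMap.comp_apply] at h2 ⊢
    rw [hS Q hQ a (aeval_apply_eq_zero_of_dvd (dvd_mul_right _ _) (hqa a)), h2, ← r.eq, map_sum,
      map_sum]
    refine Finset.sum_congr rfl fun i hi => ?_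
    rw [LinearMap.lTensor_tmul, LinearMap.lTensor_tmul, h1 i hi]
  -- The point is `S` followed by evaluation at the neutral element; equivariance identifies its
  -- translation with `S`.
  refine ⟨WithConv.toConv (AlgHom.ofLinearMap (Coalgebra.counit (R := F) ∘ₗ S) (by simp [hone])
    (by simp [hmul])), fun q hq a ha => ?_⟩
  rw [← hS q hq a ha]
  exact LinearMap.congr_fun (hequiv.eq_rid_lTensor).symm a

/-- Existence of the Jordan decomposition in `M(F)`. -/
theorem exists_jordan_points (x : Points F A) : ∃ s u : Points F A, IsSemisimple s ∧
    IsUnipotent u ∧ Commute s u ∧ x = s * u := by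
  have hT := exists_aeval_translation_eq_zero x
  obtain ⟨s, hs⟩ := exists_isSemisimplePart_translation x
  have hc := hs.commute hT (Commute.refl _)
  have hsx : Commute s x := commute_translation_iff.mp hc
  refine ⟨s, s⁻¹ * x, ?_, fun a => ?_, ((Commute.refl s).inv_right).mul_right hsx, by group⟩
  · refine Module.End.isSemisimple_of_forall_squarefree fun a => ?_
    obtain ⟨q, hq, hqa⟩ := hT a
    exact hs.exists_squarefree hq hqa
  · obtain ⟨q, hq, hqa⟩ := hT a
    obtain ⟨k, hk⟩ := hs.exists_sub_pow hq hqa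
    refine ⟨k, ?_⟩
    have h1 : translation (s⁻¹ * x) - 1 = translation s⁻¹ * (translation x - translation s) := by
      rw [mul_sub, translation_inv_mul, translation_mul]
    have h2 : Commute (translation s⁻¹) (translation x - translation s) :=
      (commute_translation_iff.mpr hsx.inv_left).sub_right
        (commute_translation_iff.mpr (Commute.refl s).inv_left)
    rw [h1, h2.mul_pow, Module.End.mul_apply, hk, map_zero]

/-- Uniqueness of the Jordan decomposition in `M(F)`. -/
theorem eq_of_jordan_points {s u s' u' : Points F A} (hs : IsSemisimple s) (hu : IsUnipotent u)
    (hsu : Commute s u) (hs' : IsSemisimple s') (hu' : IsUnipotent u') (hsu' : Commute s' u')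
    (h : s * u = s' * u') : s = s' := by
  obtain ⟨t, ht⟩ := exists_isSemisimplePart_translation (s * u)
  -- The difference of the translations by `s * u` and `s` is that by `s` times a commuting locally
  -- nilpotent operator, so `s` gives the semisimple part.
  have key : ∀ {s u x : Points F A}, IsSemisimple s → IsUnipotent u → Commute s u →
      x = s * u → IsSemisimplePart (translation x) (translation t) → s = t := by
    rintro s u x hs hu hsu rfl ht
    refine translation_injective (LinearMap.ext fun a => ?_)
    obtain ⟨q, hq, hqa⟩ := exists_aeval_translation_eq_zero (s * u) a
    obtain ⟨q', hq', hqa'⟩ := exists_aeval_translation_eq_zero s a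
    obtain ⟨R, hR, hRa⟩ := hs.exists_squarefree hq' hqa'
    have hc : Commute (translation (s * u)) (translation s) :=
      commute_translation_iff.mpr ((Commute.refl s).mul_left hsu.symm)
    rw [ht q hq a hqa, semisimplePartPoly_apply_eq hc hq hqa hR hRa]
    obtain ⟨k, hk⟩ := hu a
    refine ⟨k, ?_⟩
    have h1 : translation (s * u) - translation s = translation s * (translation u - 1) := by
      rw [mul_sub, translation_mul, mul_one]
    have h2 : Commute (translation s) (translation u - 1) :=
      (commute_translation_iff.mpr hsu).sub_right (Commute.one_right _)
    rw [h1, h2.mul_pow, Module.End.mul_apply, hk, map_zero]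
  rw [key hs hu hsu rfl ht, key hs' hu' hsu' h ht]

end JordanPoints

/-! ### Powers in unipotent subgroups -/

section PowerMap

variable {F A : Type*} [Field F] [CharZero F] [CommRing A] [HopfAlgebra F A]

/-- Raising to a nonzero power is bijective on the points of a unipotent subgroup. -/
lemma bijective_pow_subgroupPoints {n : ℕ} (hn : n ≠ 0)
    {I : Ideal A} [I.IsHopfIdeal F] (hI : IsUnipotentGroup F (A ⧸ I)) :
    Function.Bijective fun g : subgroupPoints (F := F) I => g ^ n := by
  have hu (g : subgroupPoints (F := F) I) : IsUnipotent (g : Points F A) :=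
    isUnipotent_of_mem_subgroupPoints hI g.2
  constructor
  · intro g g' h
    have h1 : g ^ n = g' ^ n := h
    have h2 : (g : Points F A) ^ n = (g' : Points F A) ^ n := by
      rw [← Subgroup.coe_pow, h1, Subgroup.coe_pow]
    exact Subtype.ext (IsUnipotent.eq_of_pow_eq (hu g) (hu g') hn h2)
  · intro g
    obtain ⟨u, hgu⟩ : ∃ u : unip F A, (u : Points F A) = g := ⟨⟨g, hu g⟩, rfl⟩
    have h1 := unipRoot_mem_subgroupPoints n I u (hgu ▸ g.2)
    have h2 := unipRoot_pow hn u
    generalize (unipRoot n u : Points F A) = r at h1 h2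
    refine ⟨⟨r, h1⟩, ?_⟩
    change (⟨r, h1⟩ : subgroupPoints (F := F) I) ^ n = g
    apply Subtype.ext
    rw [Subgroup.coe_pow, h2, hgu]

end PowerMap

/-! ### The canonical section and the Jordan decomposition in the covering -/

section Covering

variable {F A : Type*} [Field F] [CommRing A] [HopfAlgebra F A] [TopologicalSpace F]
  {E : Type*} [Group E] [TopologicalSpace E] {m : ℤ} {inc : mu m →* E} {rev : E →* Points F A}

lemma IsCovering.pow_eq_one_and_commute (h : IsCovering inc rev) (e : E) (he : rev e = 1) :
    e ^ m.natAbs = 1 ∧ ∀ y, Commute e y := by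
  obtain ⟨ε, rfl⟩ := (h.exact.mulExact e).mp he
  refine ⟨?_, h.central ε⟩
  have hε : ε ^ m = 1 := Subtype.ext ε.2
  rw [← map_pow, pow_natAbs_eq_one.mpr hε, map_one]

/-- The `|m|`-th power of any lift of `x`. -/
def IsCovering.liftPow (h : IsCovering inc rev) (x : Points F A) : E :=
  Function.surjInv h.exact.isOpenQuotientMap.surjective x ^ m.natAbs

lemma IsCovering.liftPow_apply (h : IsCovering inc rev) (e : E) :
    h.liftPow (rev e) = e ^ m.natAbs :=
  pow_eq_pow_of_map_eq h.pow_eq_one_and_commute (Function.surjInv_eq _ _)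

/-- No continuous choice of lifts is needed: `rev` is a quotient map, and the composite with it is
the power map of `E`. -/
lemma IsCovering.continuous_liftPow [IsTopologicalGroup E] (h : IsCovering inc rev) :
    Continuous h.liftPow := by
  rw [h.exact.isOpenQuotientMap.isQuotientMap.continuous_iff]
  have : h.liftPow ∘ rev = fun e => e ^ m.natAbs := funext h.liftPow_apply
  rw [this]
  exact continuous_pow _

/-- Conjugation by `y` carries `s u` to the value of `s` at the conjugate of `u`, which is `u`
itself. Thus commutation downstairs lifts, although in general it holds only up to the kernel. -/
lemma IsUnipotentSplitting.commute_of_commute {s : unip F A → E}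
    (hs : IsUnipotentSplitting rev s) {y : E} {u : unip F A}
    (h : Commute (rev y) (u : Points F A)) : Commute y (s u) := by
  obtain ⟨h1, h2⟩ := hs.conj y u
  have h3 : (⟨rev y * u * (rev y)⁻¹, h1⟩ : unip F A) = u :=
    Subtype.ext (mul_inv_eq_iff_eq_mul.mpr h.eq)
  rw [h3] at h2
  exact (mul_inv_eq_iff_eq_mul.mp h2.symm)

variable [CharZero F]

/-- The canonical section over the unipotent set: `u` is sent to the `|m|`-th power of any lift of
its `|m|`-th root. -/
def IsCovering.unipSection (h : IsCovering inc rev) (u : unip F A) : E :=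
  h.liftPow (unipRoot m.natAbs u : Points F A)

lemma IsCovering.unipSection_eq (hm : m ≠ 0) (h : IsCovering inc rev) {u : unip F A} {e : E}
    (he : rev e ∈ unip F A) (heu : rev e ^ m.natAbs = u) : h.unipSection u = e ^ m.natAbs := by
  rw [unipSection, unipRoot_eq (Int.natAbs_ne_zero.mpr hm) (v := ⟨rev e, he⟩) heu, liftPow_apply]

lemma IsCovering.exists_lift_unipRoot (hm : m ≠ 0) (h : IsCovering inc rev) (u : unip F A) :
    ∃ e : E, rev e ∈ unip F A ∧ rev e ^ m.natAbs = u := by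
  obtain ⟨e, he⟩ := h.exact.isOpenQuotientMap.surjective (unipRoot m.natAbs u : Points F A)
  exact ⟨e, he ▸ (unipRoot _ u).2, he ▸ unipRoot_pow (Int.natAbs_ne_zero.mpr hm) u⟩

lemma IsCovering.map_unipSection (hm : m ≠ 0) (h : IsCovering inc rev) (u : unip F A) :
    rev (h.unipSection u) = u := by
  obtain ⟨e, he, heu⟩ := h.exists_lift_unipRoot hm u
  rw [h.unipSection_eq hm he heu, map_pow, heu]

/-- The canonical section is multiplicative on unipotent subgroups. -/
lemma IsCovering.unipSection_mul [Algebra.FiniteType F A] (hm : m ≠ 0) (h : IsCovering inc rev)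
    {I : Ideal A} [I.IsHopfIdeal F] (hI : IsUnipotentGroup F (A ⧸ I))
    (x y : subgroupPoints (F := F) I) :
    h.unipSection ⟨x * y, isUnipotent_of_mem_subgroupPoints hI (x * y).2⟩ =
      h.unipSection ⟨x, isUnipotent_of_mem_subgroupPoints hI x.2⟩ *
        h.unipSection ⟨y, isUnipotent_of_mem_subgroupPoints hI y.2⟩ := by
  have hm' : m.natAbs ≠ 0 := Int.natAbs_ne_zero.mpr hm
  let G := subgroupPoints (F := F) I
  have hGu : ∀ g : G, (g : Points F A) ∈ unip F A := fun g =>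
    isUnipotent_of_mem_subgroupPoints hI g.2
  have hG : Group.IsNilpotent G := isNilpotent_subgroupPoints hI
  have hpow := bijective_pow_subgroupPoints (F := F) hm' hI
  -- The covering restricted to the preimage of `U(F)` is the central extension to which the
  -- group-theoretic theorem applies.
  let p : G.comap rev →* G := rev.subgroupComap G
  have hp : Function.Surjective p := fun g => by
    obtain ⟨e, he⟩ := h.exact.isOpenQuotientMap.surjective (g : Points F A)
    exact ⟨⟨e, by rw [Subgroup.mem_comap, he]; exact g.2⟩, Subtype.ext he⟩
  have hker : ∀ e, p e = 1 → e ^ m.natAbs = 1 ∧ ∀ y, Commute e y := fun e he => by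
    obtain ⟨h1, h2⟩ := h.pow_eq_one_and_commute e (congrArg Subtype.val he)
    exact ⟨Subtype.ext h1, fun y => Subtype.ext (h2 y)⟩
  let s : G → G.comap rev := fun g => ⟨h.unipSection ⟨g, hGu g⟩, by
    rw [Subgroup.mem_comap, h.map_unipSection hm]; exact g.2⟩
  have hs : ∀ e, s (p e ^ m.natAbs) = e ^ m.natAbs := fun e =>
    Subtype.ext (h.unipSection_eq hm (hGu (p e)) (by
      rw [Subgroup.coe_pow]; rfl))
  exact congrArg Subtype.val (section_mul_of_isNilpotent hpow p hp hker s hs x y)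

theorem IsCovering.isUnipotentSplitting_unipSection [IsTopologicalRing F] [IsTopologicalGroup E]
    [Algebra.FiniteType F A] (hm : m ≠ 0) (h : IsCovering inc rev) :
    IsUnipotentSplitting rev h.unipSection where
  continuous := h.continuous_liftPow.comp
    (continuous_subtype_val.comp (continuous_unipRoot m.natAbs))
  section_apply := h.map_unipSection hm
  hom I _ hI :=
    ⟨MonoidHom.mk' (fun x => h.unipSection ⟨x, isUnipotent_of_mem_subgroupPoints hI x.2⟩)
      (h.unipSection_mul hm hI), fun x => ⟨isUnipotent_of_mem_subgroupPoints hI x.2, rfl⟩⟩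
  conj y u := by
    obtain ⟨e, he, heu⟩ := h.exists_lift_unipRoot hm u
    refine ⟨IsUnipotent.conj u.2 _, ?_⟩
    rw [h.unipSection_eq hm he heu, ← conj_pow]
    refine h.unipSection_eq hm ?_ ?_
    · rw [map_mul, map_mul, map_inv]
      exact IsUnipotent.conj he _
    · rw [map_mul, map_mul, map_inv, conj_pow, heu]

/-- Any unipotent splitting is the canonical one. -/
theorem IsUnipotentSplitting.eq_unipSection (hm : m ≠ 0) (h : IsCovering inc rev)
    {s : unip F A → E} (hs : IsUnipotentSplitting rev s) : s = h.unipSection := by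
  funext u
  have hu : IsUnipotent (u : Points F A) := u.2
  -- On the closure of the powers of `u`, `s` is a homomorphism, so `s u` is the `|m|`-th power of
  -- the value of `s` at the root, which is a lift of the root.
  have := hu.isHopfIdeal_orbitIdeal
  obtain ⟨f, hf⟩ := hs.hom hu.orbitIdeal hu.isUnipotentGroup_orbitIdeal
  let x : subgroupPoints (F := F) hu.orbitIdeal := ⟨u, hu.mem_subgroupPoints_orbitIdeal⟩
  let r : subgroupPoints (F := F) hu.orbitIdeal :=
    ⟨unipRoot m.natAbs u, unipRoot_mem_subgroupPoints m.natAbs _ u x.2⟩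
  have hrx : r ^ m.natAbs = x := Subtype.ext (unipRoot_pow (Int.natAbs_ne_zero.mpr hm) u)
  obtain ⟨_, hfx⟩ := hf x
  obtain ⟨_, hfr⟩ := hf r
  have h1 : s u = f x := hfx.symm
  have h2 : s (unipRoot m.natAbs u) = f r := hfr.symm
  rw [h1, ← hrx, map_pow, ← h2, IsCovering.unipSection, ← hs.section_apply (unipRoot m.natAbs u),
    IsCovering.liftPow_apply]

/-- Existence and uniqueness of the Jordan decomposition in a covering. -/
theorem IsUnipotentSplitting.existsUnique_isJordanDecomposition {s : unip F A → E}
    (hs : IsUnipotentSplitting rev s) (x : E) :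
    ∃! p : E × unip F A, IsJordanDecomposition rev s x p.1 p.2 := by
  obtain ⟨t, u, ht, hu, htu, hx⟩ := exists_jordan_points (rev x)
  let u' : unip F A := ⟨u, hu⟩
  have h1 : rev (x * (s u')⁻¹) = t := by
    rw [map_mul, map_inv, hs.section_apply, hx, mul_inv_cancel_right]
  refine ⟨(x * (s u')⁻¹, u'), ⟨h1 ▸ ht, (inv_mul_cancel_right _ _).symm,
    hs.commute_of_commute (h1 ▸ htu)⟩, ?_⟩
  rintro ⟨σ, v⟩ ⟨hσ, hσv, hc⟩
  simp only at hσ hσv hc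
  have h2 : rev x = rev σ * v := by rw [hσv, map_mul, hs.section_apply]
  have h3 : Commute (rev σ) (v : Points F A) := by
    have := congrArg rev hc
    rwa [map_mul, map_mul, hs.section_apply] at this
  have h4 : t = rev σ := eq_of_jordan_points ht hu htu hσ v.2 h3 (hx ▸ h2)
  have h5 : v = u' := by
    rw [hx, h4] at h2
    exact Subtype.ext (mul_left_cancel h2).symm
  rw [← h5, hσv, mul_inv_cancel_right]

/-- An element commutes with `x` if and only if it commutes with both Jordan components. -/
theorem IsUnipotentSplitting.commute_iff {s : unip F A → E} (hs : IsUnipotentSplitting rev s)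
    {x σ : E} {u : unip F A} (h : IsJordanDecomposition rev s x σ u) (y : E) :
    y * x = x * y ↔ y * σ = σ * y ∧ rev y * (u : Points F A) = u * rev y := by
  constructor
  · intro hxy
    obtain ⟨h1, h2⟩ := hs.conj y u
    -- Conjugation by `y` fixes `x`, so it produces a second decomposition of `x`; uniqueness then
    -- says that `y` fixes both components.
    have h3 : IsJordanDecomposition rev s x (y * σ * y⁻¹) ⟨_, h1⟩ := by
      have h4 : x = y * σ * y⁻¹ * s ⟨_, h1⟩ := by
        rw [h2]
        calc x = y * x * y⁻¹ := by rw [hxy, mul_inv_cancel_right]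
          _ = y * (σ * s u) * y⁻¹ := by rw [← h.eq_mul]
          _ = _ := by group
      refine ⟨?_, h4, ?_⟩
      · rw [map_mul, map_mul, map_inv]
        exact IsSemisimple.conj h.semisimple _
      · rw [h2]
        calc _ = y * (σ * s u) * y⁻¹ := by group
          _ = y * (s u * σ) * y⁻¹ := by rw [h.comm]
          _ = _ := by group
    have h5 := (hs.existsUnique_isJordanDecomposition x).unique (y₁ := (σ, u))
      (y₂ := (y * σ * y⁻¹, ⟨_, h1⟩)) h h3
    obtain ⟨h6, h7⟩ := Prod.ext_iff.mp h5
    exact ⟨(mul_inv_eq_iff_eq_mul.mp h6.symm), mul_inv_eq_iff_eq_mul.mp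
      (congrArg Subtype.val h7).symm⟩
  · rintro ⟨h1, h2⟩
    rw [h.eq_mul]
    exact (show Commute y σ from h1).mul_right (hs.commute_of_commute h2)

end Covering

end AffineGroup

end

theorem mainTheorem10 {F : Type*} [Field F] [TopologicalSpace F] [IsLocalField F] [CharZero F]
    {A : Type*} [CommRing A] [HopfAlgebra F A] [Algebra.FiniteType F A]
    {E : Type*} [Group E] [TopologicalSpace E] [IsTopologicalGroup E]
    {m : ℤ} (hm : m ≠ 0)
    (inc : AffineGroup.mu m →* E) (rev : E →* AffineGroup.Points F A)
    (hrev : AffineGroup.IsCovering inc rev) :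
    (∃! s : AffineGroup.unip F A → E, AffineGroup.IsUnipotentSplitting rev s) ∧
    ∀ s : AffineGroup.unip F A → E, AffineGroup.IsUnipotentSplitting rev s →
      (∀ x : E, ∃! p : E × AffineGroup.unip F A,
        AffineGroup.IsJordanDecomposition rev s x p.1 p.2) ∧
      (∀ (x σ : E) (u : AffineGroup.unip F A),
        AffineGroup.IsJordanDecomposition rev s x σ u →
        ∀ y : E, y * x = x * y ↔
          y * σ = σ * y ∧ rev y * (u : AffineGroup.Points F A) = u * rev y) := by
  refine ⟨⟨hrev.unipSection, hrev.isUnipotentSplitting_unipSection hm,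
    fun s hs => hs.eq_unipSection hm hrev⟩, fun s hs =>
    ⟨hs.existsUnique_isJordanDecomposition, fun x σ u h y => hs.commute_iff h y⟩⟩
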